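/- Let $m\in\mathbb{R}$ and consider the conformal Schwarzschild spacetime of mass $m$ in the F-gauge (conformal Gaussian gauge) near spatial infinity, with coordinates $(\tau,\rho)$, $\kappa=\rho$ and conformal factor $$\Theta=\frac{\rho}{(1+\rho m/2)^2}\Big(1-\frac{\tau^2}{(1+\rho m/2)^2}\Big).$$ Let $c^0,c^1,c^\pm=c$ be its frame components (the unit radial frame vector orthogonal to $\partial_\tau$ is $e=c^0\partial_\tau+c^1\partial_\rho$, the angular frame vectors are $c\,X_\pm$), let $f$ and $\xi$ be its radial connection components, and let $K_r,K_t$ be the radial and tangential expansions of the congruence of conformal geodesics. These are given, for $|\tau|<1$ and $|\rho|$ small, by the smooth solution of the spherically symmetric conformal propagation equations with time symmetric Schwarzschild data at $\tau=0$. In this frame Maxwell's equations for $\phi=(\phi_0,\phi_1,\phi_2)$ are $$(1-c^0)\partial_\tau\phi_0-c^1\partial_\rho\phi_0+cX_+\phi_1=(\sqrt2\,\xi-f-K_r-K_t)\phi_0,$$ $$\partial_\tau\phi_1+\tfrac12c\,(X_+\phi_2+X_-\phi_0)=-2K_t\phi_1,$$ $$(1+c^0)\partial_\tau\phi_2+c^1\partial_\rho\phi_2+cX_-\phi_1=(f-\sqrt2\,\xi-K_r-K_t)\phi_2,$$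 $$c^0\partial_\tau\phi_1+c^1\partial_\rho\phi_1-\tfrac12c\,(X_+\phi_2-X_-\phi_0)=-2\sqrt2\,\xi\phi_1 .$$ Insert $\phi_j=\sum_{n}\sum_q\sum_{k=0}^{2q}\frac1{n!}\,a_{j,n;q,k}(\tau)\,T_{2q}{}^{k}{}_{q-1+j}\,\rho^n$, where $T_m{}^k{}_l$ are the $SU(2)$ harmonics, so that $X_\pm$ maps $T_{2q}{}^{k}{}_{l}$ to $\pm\sqrt{q(q+1)}\,T_{2q}{}^{k}{}_{l\mp1}$ for the indices that occur. The order-$n$ Maxwell transport equations in the sector $(q,k)$ are the ordinary differential equations on $-1<\tau<1$ for the $a_{j,n;q,k}$ obtained by differentiating these equations $n$ times in $\rho$, setting $\rho=0$ and taking the coefficient of the $(q,k)$ harmonics. Let $p\ge1$ and $0\le k\le 2p$. Suppose that $a_{j,n;p,k}$ ($j=0,1,2$) solve the Maxwell transport equations of all orders $n\le p+1$ in the sector $(q,k)=(p,k)$, that the $2^p$-polar harmonics are absent from the initial data below order $p$, i.e. $a_{j,n;p,k}(0)=0$ for $n<p$, and that the regularity condition $$a_{0,p;p,k}(0)=a_{2,p;p,k}(0)$$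 holds. Then $a_{0,p+1;p,k}$, $a_{1,p+1;p,k}$ and $a_{2,p+1;p,k}$ are polynomials in $\tau$ on $(-1,1)$; in particular they contain no logarithms. -/

import Mathlib

open Set
open scoped ContDiff

/-! ## The conformal Schwarzschild spacetime in the F-gauge

Coordinates: `τ` is the affine parameter along the conformal geodesics, `ρ` the radial coordinate
(`ρ = 0` is the cylinder at spatial infinity), and the conformal freedom is fixed by `κ = ρ`.
Because of the spherical symmetry all background quantities are functions of `(τ, ρ)` only.
All functions of two variables below take `τ` first and `ρ` second. -/

/-- The conformal factor `Θ = (Ω / κ) (1 - τ² κ² / ω²)` with `κ = ρ`,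
`Ω = ρ² / (1 + ρ m / 2)²` and `ω = ρ (1 + ρ m / 2)`. -/
noncomputable def conformalFactor (m τ ρ : ℝ) : ℝ :=
  ρ / (1 + ρ * m / 2) ^ 2 * (1 - τ ^ 2 / (1 + ρ * m / 2) ^ 2)

/-- The radial frame component of the 1-form `d = Θ b`, with `b` the 1-form of the congruence of
conformal geodesics. In the gauge used here it is independent of `τ`, and equal to its initial
value `κ⁻¹ e(Ω) = ∂Ω/∂ρ`, where `e = ρ ∂_ρ` on `τ = 0`. The `τ` component of `d` is `∂_τ Θ`. -/
noncomputable def radialOneForm (m ρ : ℝ) : ℝ :=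
  2 * ρ / (1 + ρ * m / 2) ^ 3

/-- The unknowns of the conformal propagation equations in spherical symmetry, in the frame made of
`∂_τ`, the unit radial vector `e = c⁰ ∂_τ + c¹ ∂_ρ` and the angular vectors `c^± X_±`. In terms of
the usual irreducible spinor components `ξ, χ₂, χ_h, Θ₂, Θ_h, Θ_x, φ` one has
`x = √2 ξ`, `Kr = χ_h - χ₂ / 3`, `Kt = χ_h + χ₂ / 6`,
`Lr = Θ₂ / 3 - Θ_h`, `Lt = - Θ₂ / 6 - Θ_h`, `P = Θ_x / √2`. -/
structure FGaugeFields where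
  /-- the `∂_τ` component of the unit radial frame vector -/
  c0 : ℝ → ℝ → ℝ
  /-- the `∂_ρ` component of the unit radial frame vector -/
  c1 : ℝ → ℝ → ℝ
  /-- the common value `c^+ = c^-` of the angular frame components -/
  c : ℝ → ℝ → ℝ
  /-- the radial component of the 1-form that relates the Weyl connection to the Levi-Civita one -/
  f : ℝ → ℝ → ℝ
  /-- the connection component `√2 ξ` (logarithmic derivative along `e` of the area radius) -/
  x : ℝ → ℝ → ℝ
  /-- radial expansion of the congruence -/
  Kr : ℝ → ℝ → ℝ
  /-- tangential expansion of the congruence -/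
  Kt : ℝ → ℝ → ℝ
  /-- radial-radial component of the Schouten tensor of the Weyl connection -/
  Lr : ℝ → ℝ → ℝ
  /-- tangential-tangential component of the Schouten tensor of the Weyl connection -/
  Lt : ℝ → ℝ → ℝ
  /-- radial-`τ` component of the Schouten tensor of the Weyl connection -/
  P : ℝ → ℝ → ℝ
  /-- the only component of the rescaled Weyl spinor -/
  phi : ℝ → ℝ → ℝ

/-- `u` is the conformal Schwarzschild spacetime of mass `m` in the F-gauge, near the cylinder at
spatial infinity: the smooth solution of the (spherically symmetric) conformal propagation
equations, with the data induced on the time symmetric hypersurface `τ = 0` by the Schwarzschild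
metric in isotropic coordinates, on a region `|τ| < 1`, `|ρ| < ρ₀`. -/
structure IsSchwarzschildFGaugeOn (m ρ₀ : ℝ) (u : FGaugeFields) : Prop where
  smooth_c0 : ContDiffOn ℝ ∞ (Function.uncurry u.c0) (Ioo (-1) 1 ×ˢ Ioo (-ρ₀) ρ₀)
  smooth_c1 : ContDiffOn ℝ ∞ (Function.uncurry u.c1) (Ioo (-1) 1 ×ˢ Ioo (-ρ₀) ρ₀)
  smooth_c : ContDiffOn ℝ ∞ (Function.uncurry u.c) (Ioo (-1) 1 ×ˢ Ioo (-ρ₀) ρ₀)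
  smooth_f : ContDiffOn ℝ ∞ (Function.uncurry u.f) (Ioo (-1) 1 ×ˢ Ioo (-ρ₀) ρ₀)
  smooth_x : ContDiffOn ℝ ∞ (Function.uncurry u.x) (Ioo (-1) 1 ×ˢ Ioo (-ρ₀) ρ₀)
  smooth_Kr : ContDiffOn ℝ ∞ (Function.uncurry u.Kr) (Ioo (-1) 1 ×ˢ Ioo (-ρ₀) ρ₀)
  smooth_Kt : ContDiffOn ℝ ∞ (Function.uncurry u.Kt) (Ioo (-1) 1 ×ˢ Ioo (-ρ₀) ρ₀)
  smooth_Lr : ContDiffOn ℝ ∞ (Function.uncurry u.Lr) (Ioo (-1) 1 ×ˢ Ioo (-ρ₀) ρ₀)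
  smooth_Lt : ContDiffOn ℝ ∞ (Function.uncurry u.Lt) (Ioo (-1) 1 ×ˢ Ioo (-ρ₀) ρ₀)
  smooth_P : ContDiffOn ℝ ∞ (Function.uncurry u.P) (Ioo (-1) 1 ×ˢ Ioo (-ρ₀) ρ₀)
  smooth_phi : ContDiffOn ℝ ∞ (Function.uncurry u.phi) (Ioo (-1) 1 ×ˢ Ioo (-ρ₀) ρ₀)
  prop_c0 : ∀ τ ∈ Ioo (-1 : ℝ) 1, ∀ ρ ∈ Ioo (-ρ₀) ρ₀,
    deriv (fun t => u.c0 t ρ) τ = -(u.Kr τ ρ * u.c0 τ ρ) - u.f τ ρ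
  prop_c1 : ∀ τ ∈ Ioo (-1 : ℝ) 1, ∀ ρ ∈ Ioo (-ρ₀) ρ₀,
    deriv (fun t => u.c1 t ρ) τ = -(u.Kr τ ρ * u.c1 τ ρ)
  prop_c : ∀ τ ∈ Ioo (-1 : ℝ) 1, ∀ ρ ∈ Ioo (-ρ₀) ρ₀,
    deriv (fun t => u.c t ρ) τ = -(u.Kt τ ρ * u.c τ ρ)
  prop_f : ∀ τ ∈ Ioo (-1 : ℝ) 1, ∀ ρ ∈ Ioo (-ρ₀) ρ₀,
    deriv (fun t => u.f t ρ) τ = -(u.Kr τ ρ * u.f τ ρ) + u.P τ ρ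
  prop_x : ∀ τ ∈ Ioo (-1 : ℝ) 1, ∀ ρ ∈ Ioo (-ρ₀) ρ₀,
    deriv (fun t => u.x t ρ) τ =
      -(u.Kt τ ρ * u.x τ ρ) + (u.Kr τ ρ - u.Kt τ ρ) * u.f τ ρ - u.P τ ρ
  prop_Kr : ∀ τ ∈ Ioo (-1 : ℝ) 1, ∀ ρ ∈ Ioo (-ρ₀) ρ₀,
    deriv (fun t => u.Kr t ρ) τ =
      -(u.Kr τ ρ) ^ 2 + u.Lr τ ρ - conformalFactor m τ ρ * u.phi τ ρ / 3
  prop_Kt : ∀ τ ∈ Ioo (-1 : ℝ) 1, ∀ ρ ∈ Ioo (-ρ₀) ρ₀,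
    deriv (fun t => u.Kt t ρ) τ =
      -(u.Kt τ ρ) ^ 2 + u.Lt τ ρ + conformalFactor m τ ρ * u.phi τ ρ / 6
  prop_Lr : ∀ τ ∈ Ioo (-1 : ℝ) 1, ∀ ρ ∈ Ioo (-ρ₀) ρ₀,
    deriv (fun t => u.Lr t ρ) τ =
      -(u.Kr τ ρ * u.Lr τ ρ) - deriv (fun t => conformalFactor m t ρ) τ * u.phi τ ρ / 3
  prop_Lt : ∀ τ ∈ Ioo (-1 : ℝ) 1, ∀ ρ ∈ Ioo (-ρ₀) ρ₀,
    deriv (fun t => u.Lt t ρ) τ =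
      -(u.Kt τ ρ * u.Lt τ ρ) + deriv (fun t => conformalFactor m t ρ) τ * u.phi τ ρ / 6
  prop_P : ∀ τ ∈ Ioo (-1 : ℝ) 1, ∀ ρ ∈ Ioo (-ρ₀) ρ₀,
    deriv (fun t => u.P t ρ) τ = -(u.Kr τ ρ * u.P τ ρ) - radialOneForm m ρ * u.phi τ ρ / 3
  prop_phi : ∀ τ ∈ Ioo (-1 : ℝ) 1, ∀ ρ ∈ Ioo (-ρ₀) ρ₀,
    deriv (fun t => u.phi t ρ) τ = -(3 * u.Kt τ ρ * u.phi τ ρ)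
  init_c0 : ∀ ρ ∈ Ioo (-ρ₀) ρ₀, u.c0 0 ρ = 0
  init_c1 : ∀ ρ ∈ Ioo (-ρ₀) ρ₀, u.c1 0 ρ = ρ
  init_c : ∀ ρ ∈ Ioo (-ρ₀) ρ₀, u.c 0 ρ = 1
  init_f : ∀ ρ ∈ Ioo (-ρ₀) ρ₀, u.f 0 ρ = 1
  init_x : ∀ ρ ∈ Ioo (-ρ₀) ρ₀, u.x 0 ρ = 0
  init_Kr : ∀ ρ ∈ Ioo (-ρ₀) ρ₀, u.Kr 0 ρ = 0
  init_Kt : ∀ ρ ∈ Ioo (-ρ₀) ρ₀, u.Kt 0 ρ = 0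
  init_Lr : ∀ ρ ∈ Ioo (-ρ₀) ρ₀, u.Lr 0 ρ = 2 * m * conformalFactor m 0 ρ
  init_Lt : ∀ ρ ∈ Ioo (-ρ₀) ρ₀, u.Lt 0 ρ = -(m * conformalFactor m 0 ρ)
  init_P : ∀ ρ ∈ Ioo (-ρ₀) ρ₀, u.P 0 ρ = 0
  init_phi : ∀ ρ ∈ Ioo (-ρ₀) ρ₀, u.phi 0 ρ = -6 * m

/-! ## The Maxwell transport equations on the cylinder at spatial infinity

In the frame above, Maxwell's equations for `φ = (φ₀, φ₁, φ₂)` are the propagation equations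

* `(1 - c⁰) ∂_τ φ₀ - c¹ ∂_ρ φ₀ + c X_+ φ₁ = (√2 ξ - f - Kr - Kt) φ₀`,
* `∂_τ φ₁ + (1/2) c (X_+ φ₂ + X_- φ₀) = - 2 Kt φ₁`,
* `(1 + c⁰) ∂_τ φ₂ + c¹ ∂_ρ φ₂ + c X_- φ₁ = (f - √2 ξ - Kr - Kt) φ₂`,

together with the constraint

* `c⁰ ∂_τ φ₁ + c¹ ∂_ρ φ₁ - (1/2) c (X_+ φ₂ - X_- φ₀) = - 2 √2 ξ φ₁`.

The transport equations of order `n` are the `n`-th `ρ`-derivatives of these at `ρ = 0`, expanded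
by Leibniz' rule. With `φ_j = ∑ (1/n!) a_{j,n;q,k}(τ) T_{2q}^k_{q-1+j} ρⁿ` and
`X_± T_{2q}^k_{q-1+j} = ± √(q(q+1)) T_{2q}^k_{q-1+j∓1}` (for the values of `j` that occur)
they are ordinary differential equations for the coefficients `a_{j,n;q,k}`. -/

/-- The `i`-th Taylor derivative `g^{(i)}(τ) = (∂_ρ^i g)(τ, 0)` of a background function on the
cylinder at spatial infinity, as a complex number. -/
noncomputable def rhoJet (g : ℝ → ℝ → ℝ) (i : ℕ) (τ : ℝ) : ℂ :=
  ((iteratedDeriv i (fun ρ => g τ ρ) 0 : ℝ) : ℂ)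

/-- `√(q (q + 1))`. -/
noncomputable def modeFactor (q : ℕ) : ℂ :=
  ((Real.sqrt ((q : ℝ) * ((q : ℝ) + 1)) : ℝ) : ℂ)

/-- The order `n` Maxwell transport equations in the harmonic sector `(q, k)`, for the coefficients
`a j n q k = a_{j,n;q,k}`, on the cylinder `|τ| < 1`. The coefficient of order `n + 1`, which
appears formally in the summand `i = 0`, is multiplied there by the value `c¹(τ, 0) = 0`. -/
structure MaxwellTransport (u : FGaugeFields) (a : Fin 3 → ℕ → ℕ → ℕ → ℝ → ℂ) (n q k : ℕ) :
    Prop where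
  differentiable : ∀ j : Fin 3, ∀ τ ∈ Ioo (-1 : ℝ) 1, DifferentiableAt ℝ (a j n q k) τ
  propagation_zero : ∀ τ ∈ Ioo (-1 : ℝ) 1,
    ∑ i ∈ Finset.range (n + 1), (n.choose i : ℂ) *
      (rhoJet (fun t ρ => 1 - u.c0 t ρ) i τ * deriv (a 0 (n - i) q k) τ
        - rhoJet u.c1 i τ * a 0 (n - i + 1) q k τ
        + modeFactor q * rhoJet u.c i τ * a 1 (n - i) q k τ) =
    ∑ i ∈ Finset.range (n + 1), (n.choose i : ℂ) *
      (rhoJet (fun t ρ => u.x t ρ - u.f t ρ - u.Kr t ρ - u.Kt t ρ) i τ * a 0 (n - i) q k τ)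
  propagation_one : ∀ τ ∈ Ioo (-1 : ℝ) 1,
    deriv (a 1 n q k) τ
      + ∑ i ∈ Finset.range (n + 1), (n.choose i : ℂ) *
        (1 / 2 * modeFactor q * rhoJet u.c i τ * (a 2 (n - i) q k τ - a 0 (n - i) q k τ)) =
    ∑ i ∈ Finset.range (n + 1), (n.choose i : ℂ) *
      (-2 * rhoJet u.Kt i τ * a 1 (n - i) q k τ)
  propagation_two : ∀ τ ∈ Ioo (-1 : ℝ) 1,
    ∑ i ∈ Finset.range (n + 1), (n.choose i : ℂ) *
      (rhoJet (fun t ρ => 1 + u.c0 t ρ) i τ * deriv (a 2 (n - i) q k) τ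
        + rhoJet u.c1 i τ * a 2 (n - i + 1) q k τ
        - modeFactor q * rhoJet u.c i τ * a 1 (n - i) q k τ) =
    ∑ i ∈ Finset.range (n + 1), (n.choose i : ℂ) *
      (rhoJet (fun t ρ => u.f t ρ - u.x t ρ - u.Kr t ρ - u.Kt t ρ) i τ * a 2 (n - i) q k τ)
  constraint : ∀ τ ∈ Ioo (-1 : ℝ) 1,
    ∑ i ∈ Finset.range (n + 1), (n.choose i : ℂ) *
      (rhoJet u.c0 i τ * deriv (a 1 (n - i) q k) τ
        + rhoJet u.c1 i τ * a 1 (n - i + 1) q k τ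
        - 1 / 2 * modeFactor q * rhoJet u.c i τ * (a 2 (n - i) q k τ + a 0 (n - i) q k τ)) =
    ∑ i ∈ Finset.range (n + 1), (n.choose i : ℂ) *
      (-2 * rhoJet u.x i τ * a 1 (n - i) q k τ)

/-!
On the cylinder `ρ = 0` the background is explicit: the propagation equations there are solved by
`c⁰ = -τ`, `c = f = 1`, `φ = -6 m` and zero for the other fields, and the Taylor coefficients
needed beyond that (first order in `ρ`, and second order for `c¹`, which vanishes on the cylinder)
are obtained by integrating polynomials in `τ`, because `ρ`- and `τ`-derivatives commute
(`hasDerivAt_realJet`).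

In the transport equations of order `n` put `μ = √(p (p + 1))` and `w = μ (a₀ - a₂) / 2`. The
constraint expresses `a₀ + a₂` by `a₁` and `w`, and what is left is
`a₁' = w` and `(1 - τ²) w' = (n (n - 1) - p (p + 1)) a₁ - 2 (n - 1) τ w`, up to sources
(`difference_equation`). It is regular on `(-1, 1)`, so the orders `n < p`, with vanishing data,
vanish (`vanish_below`). At order `p` the regularity condition is `w = 0` at `τ = 0`, and the
solution is `a₁ = A (1 - τ²)^p` (`order_eq`), hence `μ a₀ = A p (1 - τ)² (1 - τ²)^(p-1)` and
`μ a₂ = A p (1 + τ)² (1 - τ²)^(p-1)`.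

At order `n = p + 1` the coefficient of `a₁` vanishes, so `w` solves the scalar equation
`(1 - τ²) w' = - 2 p τ w + T` with a source `T` proportional to `m A`, whose homogeneous solutions
are the multiples of the polynomial `(1 - τ²)^p`. In general the integral of `T / (1 - τ²)^(p+1)`
contains logarithms at `τ = ± 1`; for the Schwarzschild source it does not, because
`m (p + 1) A (p / 3) τ³ (((p + 3) τ² - 2) (1 - τ²)^(p-1) - 6 (p - 1) (1 - τ²)^(p-2))`
is a particular solution (`hasDerivAt_particularDifference`). So `w` is a polynomial, `a₁` is a
primitive of a polynomial, and the constraint gives `a₀` and `a₂`.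
-/

/-! ### Linear ordinary differential equations on `(-1, 1)` -/

/-- Uniqueness for homogeneous linear equations with locally bounded coefficients, in the form of a
differential inequality: Grönwall's lemma on both sides of `0`. -/
theorem eq_zero_of_norm_deriv_le {E : Type*} [NormedAddCommGroup E] [NormedSpace ℝ E]
    {y y' : ℝ → E} {g : ℝ → ℝ} (hg : ContinuousOn g (Ioo (-1) 1))
    (hy : ∀ τ ∈ Ioo (-1 : ℝ) 1, HasDerivAt y (y' τ) τ) (h0 : y 0 = 0)
    (hb : ∀ τ ∈ Ioo (-1 : ℝ) 1, ‖y' τ‖ ≤ g τ * ‖y τ‖) :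
    ∀ τ ∈ Ioo (-1 : ℝ) 1, y τ = 0 := by
  have forward : ∀ {z z' : ℝ → E} {g : ℝ → ℝ}, ContinuousOn g (Ioo (-1) 1) →
      (∀ τ ∈ Ioo (-1 : ℝ) 1, HasDerivAt z (z' τ) τ) → z 0 = 0 →
      (∀ τ ∈ Ioo (-1 : ℝ) 1, ‖z' τ‖ ≤ g τ * ‖z τ‖) → ∀ τ ∈ Ico (0 : ℝ) 1, z τ = 0 := by
    intro z z' g hg hz h0 hb τ hτ
    have hsub : Icc 0 τ ⊆ Ioo (-1 : ℝ) 1 := fun t ht =>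
      ⟨by linarith [ht.1], lt_of_le_of_lt ht.2 hτ.2⟩
    obtain ⟨K, hK⟩ := isCompact_Icc.bddAbove_image (hg.mono hsub)
    refine eq_zero_of_abs_deriv_le_mul_abs_self_of_eq_zero_right (f' := z') (K := K)
      (fun t ht => (hz t (hsub ht)).continuousAt.continuousWithinAt)
      (fun t ht => (hz t (hsub ⟨ht.1, ht.2.le⟩)).hasDerivWithinAt) h0
      (fun t ht => ?_) τ ⟨hτ.1, le_rfl⟩
    have ht' : t ∈ Icc 0 τ := ⟨ht.1, ht.2.le⟩
    exact (hb t (hsub ht')).trans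
      (mul_le_mul_of_nonneg_right (hK (mem_image_of_mem g ht')) (norm_nonneg _))
  intro τ hτ
  rcases le_total 0 τ with h | h
  · exact forward hg hy h0 hb τ ⟨h, hτ.2⟩
  · have hneg : MapsTo (fun t : ℝ => -t) (Ioo (-1 : ℝ) 1) (Ioo (-1 : ℝ) 1) :=
      fun t ht => ⟨by linarith [ht.2], by linarith [ht.1]⟩
    have := forward (z := fun t => y (-t)) (z' := fun t => -y' (-t)) (g := fun t => g (-t))
      (hg.comp continuous_neg.continuousOn hneg)
      (fun t ht => by
        have := (hy (-t) (hneg ht)).scomp t (hasDerivAt_neg t)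
        simpa [Function.comp_def] using this)
      (by simpa using h0) (fun t ht => by simpa using hb (-t) (hneg ht)) (-τ)
      ⟨by linarith, by linarith [hτ.1]⟩
    simpa using this

theorem eq_of_hasDerivAt_eq {E : Type*} [NormedAddCommGroup E] [NormedSpace ℝ E]
    {y z y' : ℝ → E} (hy : ∀ τ ∈ Ioo (-1 : ℝ) 1, HasDerivAt y (y' τ) τ)
    (hz : ∀ τ ∈ Ioo (-1 : ℝ) 1, HasDerivAt z (y' τ) τ) (h0 : y 0 = z 0) :
    ∀ τ ∈ Ioo (-1 : ℝ) 1, y τ = z τ := by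
  intro τ hτ
  have := eq_zero_of_norm_deriv_le (y := fun t => y t - z t) (g := fun _ => 0)
    (y' := fun _ => 0) continuousOn_const
    (fun t ht => by simpa using (hy t ht).fun_sub (hz t ht)) (by simp [h0]) (by simp) τ hτ
  exact sub_eq_zero.mp this

/-! ### Taylor coefficients in `ρ` of a smooth function of `(τ, ρ)` -/

/-- The real-valued `i`-th `ρ`-derivative of `g` at `ρ = 0`, as a function of `τ`; `rhoJet` is its
complexification. -/
noncomputable def realJet (g : ℝ → ℝ → ℝ) (i : ℕ) (τ : ℝ) : ℝ :=
  iteratedDeriv i (fun ρ => g τ ρ) 0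

section Jets

variable {I J : Set ℝ} {G : ℝ → ℝ → ℝ}

theorem deriv_snd_eq_fderiv (hI : IsOpen I) (hJ : IsOpen J)
    (hG : ContDiffOn ℝ ∞ (Function.uncurry G) (I ×ˢ J)) {t r : ℝ} (ht : t ∈ I) (hr : r ∈ J) :
    deriv (G t) r = fderiv ℝ (Function.uncurry G) (t, r) (0, 1) := by
  have h := ((hG.contDiffAt ((hI.prod hJ).mem_nhds (x := (t, r)) ⟨ht, hr⟩)).differentiableAt
    (by simp)).hasFDerivAt
  exact (HasFDerivAt.comp_hasDerivAt (f := fun r => (t, r)) r h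
    ((hasDerivAt_const r t).prodMk (hasDerivAt_id r))).deriv

theorem deriv_fst_eq_fderiv (hI : IsOpen I) (hJ : IsOpen J)
    (hG : ContDiffOn ℝ ∞ (Function.uncurry G) (I ×ˢ J)) {t r : ℝ} (ht : t ∈ I) (hr : r ∈ J) :
    deriv (fun t => G t r) t = fderiv ℝ (Function.uncurry G) (t, r) (1, 0) := by
  have h := ((hG.contDiffAt ((hI.prod hJ).mem_nhds (x := (t, r)) ⟨ht, hr⟩)).differentiableAt
    (by simp)).hasFDerivAt
  exact (HasFDerivAt.comp_hasDerivAt (f := fun t => (t, r)) t h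
    ((hasDerivAt_id t).prodMk (hasDerivAt_const t r))).deriv

theorem contDiffOn_deriv_snd (hI : IsOpen I) (hJ : IsOpen J)
    (hG : ContDiffOn ℝ ∞ (Function.uncurry G) (I ×ˢ J)) :
    ContDiffOn ℝ ∞ (Function.uncurry fun t r => deriv (G t) r) (I ×ˢ J) := by
  have h : ContDiffOn ℝ ∞ (fun z => fderiv ℝ (Function.uncurry G) z (0, 1)) (I ×ˢ J) :=
    (hG.fderiv_of_isOpen (hI.prod hJ) (by simp)).clm_apply contDiffOn_const
  exact h.congr fun z hz => deriv_snd_eq_fderiv hI hJ hG hz.1 hz.2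

theorem deriv_fst_deriv_snd_comm (hI : IsOpen I) (hJ : IsOpen J)
    (hG : ContDiffOn ℝ ∞ (Function.uncurry G) (I ×ˢ J)) {t r : ℝ} (ht : t ∈ I) (hr : r ∈ J) :
    deriv (fun t => deriv (G t) r) t = deriv (fun r => deriv (fun t => G t r) t) r := by
  have hat := hG.contDiffAt ((hI.prod hJ).mem_nhds (x := (t, r)) ⟨ht, hr⟩)
  have hsymm := hat.isSymmSndFDerivAt (by
    rw [minSmoothness_of_isRCLikeNormedField]; exact ENat.LEInfty.out)
  have h2 : HasFDerivAt (fderiv ℝ (Function.uncurry G))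
      (fderiv ℝ (fderiv ℝ (Function.uncurry G)) (t, r)) (t, r) :=
    ((hat.fderiv_right (m := ∞) (by simp)).differentiableAt (by simp)).hasFDerivAt
  have e1 : (fun t => deriv (G t) r) =ᶠ[nhds t]
      fun t => fderiv ℝ (Function.uncurry G) (t, r) (0, 1) := by
    filter_upwards [hI.mem_nhds ht] with t' ht' using deriv_snd_eq_fderiv hI hJ hG ht' hr
  have e2 : (fun r => deriv (fun t => G t r) t) =ᶠ[nhds r]
      fun r => fderiv ℝ (Function.uncurry G) (t, r) (1, 0) := by
    filter_upwards [hJ.mem_nhds hr] with r' hr' using deriv_fst_eq_fderiv hI hJ hG ht hr'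
  have d1 := (HasFDerivAt.comp_hasDerivAt (f := fun t => (t, r)) t h2
    ((hasDerivAt_id t).prodMk (hasDerivAt_const t r))).clm_apply
      (hasDerivAt_const t ((0, 1) : ℝ × ℝ))
  have d2 := (HasFDerivAt.comp_hasDerivAt (f := fun r => (t, r)) r h2
    ((hasDerivAt_const r t).prodMk (hasDerivAt_id r))).clm_apply
      (hasDerivAt_const r ((1, 0) : ℝ × ℝ))
  rw [e1.deriv_eq, e2.deriv_eq]
  refine d1.deriv.trans (Eq.trans ?_ d2.deriv.symm)
  simpa using hsymm (1, 0) (0, 1)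

/-- The `τ`-derivative of a Taylor coefficient in `ρ` is the Taylor coefficient of the
`τ`-derivative. -/
theorem hasDerivAt_realJet (hI : IsOpen I) (hJ : IsOpen J) (h0 : (0 : ℝ) ∈ J)
    (hG : ContDiffOn ℝ ∞ (Function.uncurry G) (I ×ˢ J)) {τ : ℝ} (hτ : τ ∈ I) (i : ℕ) :
    HasDerivAt (realJet G i) (iteratedDeriv i (fun ρ => deriv (fun t => G t ρ) τ) 0) τ := by
  induction i generalizing G with
  | zero =>
    have h := ((hG.contDiffAt ((hI.prod hJ).mem_nhds (x := (τ, (0 : ℝ))) ⟨hτ, h0⟩)).differentiableAt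
      (by simp)).comp τ (f := fun t : ℝ => (t, (0 : ℝ))) (by fun_prop)
    have e : realJet G 0 = fun t => G t 0 := by
      funext t
      simp [realJet]
    rw [e, iteratedDeriv_zero]
    exact h.hasDerivAt
  | succ i ih =>
    have h := ih (contDiffOn_deriv_snd hI hJ hG)
    have e : (fun ρ => deriv (fun t => deriv (G t) ρ) τ) =ᶠ[nhds 0]
        deriv fun ρ => deriv (fun t => G t ρ) τ := by
      filter_upwards [hJ.mem_nhds h0] with ρ hρ using deriv_fst_deriv_snd_comm hI hJ hG hτ hρ
    rw [e.iteratedDeriv_eq, ← iteratedDeriv_succ'] at h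
    refine h.congr_of_eventuallyEq (Filter.Eventually.of_forall fun t => ?_)
    simp only [realJet, iteratedDeriv_succ']

theorem contDiffAt_radial (hI : IsOpen I) (hJ : IsOpen J) (h0 : (0 : ℝ) ∈ J)
    (hG : ContDiffOn ℝ ∞ (Function.uncurry G) (I ×ˢ J)) {τ : ℝ} (hτ : τ ∈ I) :
    ContDiffAt ℝ ∞ (G τ) 0 :=
  (hG.contDiffAt ((hI.prod hJ).mem_nhds (x := (τ, (0 : ℝ))) ⟨hτ, h0⟩)).comp (0 : ℝ)
    (f := fun r : ℝ => (τ, r)) (by fun_prop)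

theorem hasDerivAt_radial (hI : IsOpen I) (hJ : IsOpen J) (h0 : (0 : ℝ) ∈ J)
    (hG : ContDiffOn ℝ ∞ (Function.uncurry G) (I ×ˢ J)) {τ : ℝ} (hτ : τ ∈ I) :
    HasDerivAt (G τ) (realJet G 1 τ) 0 := by
  simpa [realJet] using
    ((contDiffAt_radial hI hJ h0 hG hτ).differentiableAt (by simp)).hasDerivAt

end Jets

/-! ### The background on the cylinder at spatial infinity -/

theorem hasDerivAt_quintic (a₀ a₁ a₂ a₃ a₄ a₅ t : ℝ) :
    HasDerivAt (fun t : ℝ => a₀ + a₁ * t + a₂ * t ^ 2 + a₃ * t ^ 3 + a₄ * t ^ 4 + a₅ * t ^ 5)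
      (a₁ + 2 * a₂ * t + 3 * a₃ * t ^ 2 + 4 * a₄ * t ^ 3 + 5 * a₅ * t ^ 4) t := by
  have h := (((((hasDerivAt_const t a₀).fun_add ((hasDerivAt_id' t).const_mul a₁)).fun_add
    ((hasDerivAt_pow 2 t).const_mul a₂)).fun_add ((hasDerivAt_pow 3 t).const_mul a₃)).fun_add
    ((hasDerivAt_pow 4 t).const_mul a₄)).fun_add ((hasDerivAt_pow 5 t).const_mul a₅)
  refine h.congr_deriv ?_
  norm_num
  ring

theorem eq_quintic_of_hasDerivAt {y y' : ℝ → ℝ} (a₀ a₁ a₂ a₃ a₄ a₅ : ℝ)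
    (hy : ∀ τ ∈ Ioo (-1 : ℝ) 1, HasDerivAt y (y' τ) τ)
    (hy' : ∀ τ ∈ Ioo (-1 : ℝ) 1,
      y' τ = a₁ + 2 * a₂ * τ + 3 * a₃ * τ ^ 2 + 4 * a₄ * τ ^ 3 + 5 * a₅ * τ ^ 4)
    (h0 : y 0 = a₀) :
    ∀ τ ∈ Ioo (-1 : ℝ) 1,
      y τ = a₀ + a₁ * τ + a₂ * τ ^ 2 + a₃ * τ ^ 3 + a₄ * τ ^ 4 + a₅ * τ ^ 5 :=
  eq_of_hasDerivAt_eq (fun τ hτ => hy' τ hτ ▸ hy τ hτ)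
    (fun τ _ => hasDerivAt_quintic a₀ a₁ a₂ a₃ a₄ a₅ τ) (by simpa using h0)

theorem zero_mem_Ioo_neg {r : ℝ} (hr : 0 < r) : (0 : ℝ) ∈ Ioo (-r) r := ⟨by linarith, hr⟩

section Jets

variable {ρ₀ : ℝ} {G : ℝ → ℝ → ℝ} {H : ℝ → ℝ} {τ H' : ℝ}

theorem hasDerivAt_axis (hρ₀ : 0 < ρ₀)
    (hG : ContDiffOn ℝ ∞ (Function.uncurry G) (Ioo (-1) 1 ×ˢ Ioo (-ρ₀) ρ₀))
    (hτ : τ ∈ Ioo (-1 : ℝ) 1) (hH : ∀ ρ ∈ Ioo (-ρ₀) ρ₀, deriv (fun t => G t ρ) τ = H ρ) :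
    HasDerivAt (fun t => G t 0) (H 0) τ := by
  have h0 := zero_mem_Ioo_neg hρ₀
  have h := hasDerivAt_realJet isOpen_Ioo isOpen_Ioo h0 hG hτ 0
  have e : realJet G 0 = fun t => G t 0 := by
    funext t
    simp [realJet]
  rwa [e, iteratedDeriv_zero, hH 0 h0] at h

theorem hasDerivAt_realJet_of_deriv_eq (hρ₀ : 0 < ρ₀)
    (hG : ContDiffOn ℝ ∞ (Function.uncurry G) (Ioo (-1) 1 ×ˢ Ioo (-ρ₀) ρ₀))
    (hτ : τ ∈ Ioo (-1 : ℝ) 1) (hH : ∀ ρ ∈ Ioo (-ρ₀) ρ₀, deriv (fun t => G t ρ) τ = H ρ) (i : ℕ) :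
    HasDerivAt (realJet G i) (iteratedDeriv i H 0) τ := by
  have h0 := zero_mem_Ioo_neg hρ₀
  have h := hasDerivAt_realJet isOpen_Ioo isOpen_Ioo h0 hG hτ i
  have e : (fun ρ => deriv (fun t => G t ρ) τ) =ᶠ[nhds 0] H := by
    filter_upwards [isOpen_Ioo.mem_nhds h0] with ρ hρ using hH ρ hρ
  rwa [e.iteratedDeriv_eq] at h

theorem hasDerivAt_realJet_one (hρ₀ : 0 < ρ₀)
    (hG : ContDiffOn ℝ ∞ (Function.uncurry G) (Ioo (-1) 1 ×ˢ Ioo (-ρ₀) ρ₀))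
    (hτ : τ ∈ Ioo (-1 : ℝ) 1) (hH : ∀ ρ ∈ Ioo (-ρ₀) ρ₀, deriv (fun t => G t ρ) τ = H ρ)
    (hH' : HasDerivAt H H' 0) : HasDerivAt (realJet G 1) H' τ := by
  simpa [hH'.deriv] using hasDerivAt_realJet_of_deriv_eq hρ₀ hG hτ hH 1

theorem realJet_eq_of_eq (hρ₀ : 0 < ρ₀) (hH : ∀ ρ ∈ Ioo (-ρ₀) ρ₀, G τ ρ = H ρ) (i : ℕ) :
    realJet G i τ = iteratedDeriv i H 0 := by
  have e : G τ =ᶠ[nhds 0] H := by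
    filter_upwards [isOpen_Ioo.mem_nhds (zero_mem_Ioo_neg hρ₀)] with ρ hρ using hH ρ hρ
  exact e.iteratedDeriv_eq i

theorem realJet_one_of_eq (hρ₀ : 0 < ρ₀) (hH : ∀ ρ ∈ Ioo (-ρ₀) ρ₀, G τ ρ = H ρ)
    (hH' : HasDerivAt H H' 0) : realJet G 1 τ = H' := by
  simpa [hH'.deriv] using realJet_eq_of_eq hρ₀ hH 1

theorem continuousOn_axis (hρ₀ : 0 < ρ₀)
    (hG : ContDiffOn ℝ ∞ (Function.uncurry G) (Ioo (-1) 1 ×ˢ Ioo (-ρ₀) ρ₀)) :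
    ContinuousOn (fun t => G t 0) (Ioo (-1) 1) := fun _ hτ =>
  (hasDerivAt_axis hρ₀ hG hτ fun _ _ => rfl).continuousAt.continuousWithinAt

end Jets

theorem conformalFactor_axis (m τ : ℝ) : conformalFactor m τ 0 = 0 := by
  simp [conformalFactor]

theorem hasDerivAt_conformalFactor_radial (m τ : ℝ) :
    HasDerivAt (conformalFactor m τ) (1 - τ ^ 2) 0 := by
  have hd : HasDerivAt (fun ρ : ℝ => 1 + ρ * m / 2) (m / 2) 0 := by
    simpa using (((hasDerivAt_id' (0 : ℝ)).mul_const m).div_const 2).const_add 1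
  have h := ((hasDerivAt_id' (0 : ℝ)).fun_div (hd.fun_pow 2) (by simp)).fun_mul
    (((hasDerivAt_const (0 : ℝ) (τ ^ 2)).fun_div (hd.fun_pow 2) (by simp)).const_sub 1)
  exact h.congr_deriv (by simp)

theorem deriv_conformalFactor (m τ ρ : ℝ) :
    deriv (fun t => conformalFactor m t ρ) τ = -2 * τ * ρ / (1 + ρ * m / 2) ^ 4 := by
  have h := ((((hasDerivAt_pow 2 τ).div_const ((1 + ρ * m / 2) ^ 2)).const_sub 1).const_mul
    (ρ / (1 + ρ * m / 2) ^ 2)).deriv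
  refine h.trans ?_
  rw [show (1 + ρ * m / 2) ^ 4 = (1 + ρ * m / 2) ^ 2 * (1 + ρ * m / 2) ^ 2 by ring]
  rw [mul_neg, div_mul_div_comm, ← neg_div]
  congr 1
  norm_num
  ring

theorem deriv_conformalFactor_axis (m τ : ℝ) :
    deriv (fun t => conformalFactor m t 0) τ = 0 := by
  simp [deriv_conformalFactor]

theorem hasDerivAt_deriv_conformalFactor_radial (m τ : ℝ) :
    HasDerivAt (fun ρ => deriv (fun t => conformalFactor m t ρ) τ) (-2 * τ) 0 := by
  have hd : HasDerivAt (fun ρ : ℝ => 1 + ρ * m / 2) (m / 2) 0 := by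
    simpa using (((hasDerivAt_id' (0 : ℝ)).mul_const m).div_const 2).const_add 1
  simp only [deriv_conformalFactor]
  exact (((hasDerivAt_id' (0 : ℝ)).const_mul (-2 * τ)).fun_div (hd.fun_pow 4)
    (by simp)).congr_deriv (by simp)

theorem hasDerivAt_radialOneForm (m : ℝ) : HasDerivAt (radialOneForm m) 2 0 := by
  have hd : HasDerivAt (fun ρ : ℝ => 1 + ρ * m / 2) (m / 2) 0 := by
    simpa using (((hasDerivAt_id' (0 : ℝ)).mul_const m).div_const 2).const_add 1
  exact (((hasDerivAt_id' (0 : ℝ)).const_mul 2).fun_div (hd.fun_pow 3)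
    (by simp)).congr_deriv (by simp)

theorem radialOneForm_axis (m : ℝ) : radialOneForm m 0 = 0 := by simp [radialOneForm]

namespace IsSchwarzschildFGaugeOn

variable {m ρ₀ : ℝ} {u : FGaugeFields}

theorem Lr_axis (hu : IsSchwarzschildFGaugeOn m ρ₀ u) (hρ₀ : 0 < ρ₀) :
    ∀ τ ∈ Ioo (-1 : ℝ) 1, u.Lr τ 0 = 0 :=
  eq_zero_of_norm_deriv_le (g := fun τ => |u.Kr τ 0|) (continuousOn_axis hρ₀ hu.smooth_Kr).abs
    (fun τ hτ => hasDerivAt_axis hρ₀ hu.smooth_Lr hτ (hu.prop_Lr τ hτ))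
    (by simp [hu.init_Lr 0 (zero_mem_Ioo_neg hρ₀), conformalFactor_axis])
    (fun τ _ => by simp [deriv_conformalFactor_axis])

theorem Lt_axis (hu : IsSchwarzschildFGaugeOn m ρ₀ u) (hρ₀ : 0 < ρ₀) :
    ∀ τ ∈ Ioo (-1 : ℝ) 1, u.Lt τ 0 = 0 :=
  eq_zero_of_norm_deriv_le (g := fun τ => |u.Kt τ 0|) (continuousOn_axis hρ₀ hu.smooth_Kt).abs
    (fun τ hτ => hasDerivAt_axis hρ₀ hu.smooth_Lt hτ (hu.prop_Lt τ hτ))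
    (by simp [hu.init_Lt 0 (zero_mem_Ioo_neg hρ₀), conformalFactor_axis])
    (fun τ _ => by simp [deriv_conformalFactor_axis])

theorem Kr_axis (hu : IsSchwarzschildFGaugeOn m ρ₀ u) (hρ₀ : 0 < ρ₀) :
    ∀ τ ∈ Ioo (-1 : ℝ) 1, u.Kr τ 0 = 0 :=
  eq_zero_of_norm_deriv_le (g := fun τ => |u.Kr τ 0|) (continuousOn_axis hρ₀ hu.smooth_Kr).abs
    (fun τ hτ => hasDerivAt_axis hρ₀ hu.smooth_Kr hτ (hu.prop_Kr τ hτ))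
    (hu.init_Kr 0 (zero_mem_Ioo_neg hρ₀))
    (fun τ hτ => by simp [conformalFactor_axis, hu.Lr_axis hρ₀ τ hτ, sq])

theorem Kt_axis (hu : IsSchwarzschildFGaugeOn m ρ₀ u) (hρ₀ : 0 < ρ₀) :
    ∀ τ ∈ Ioo (-1 : ℝ) 1, u.Kt τ 0 = 0 :=
  eq_zero_of_norm_deriv_le (g := fun τ => |u.Kt τ 0|) (continuousOn_axis hρ₀ hu.smooth_Kt).abs
    (fun τ hτ => hasDerivAt_axis hρ₀ hu.smooth_Kt hτ (hu.prop_Kt τ hτ))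
    (hu.init_Kt 0 (zero_mem_Ioo_neg hρ₀))
    (fun τ hτ => by simp [conformalFactor_axis, hu.Lt_axis hρ₀ τ hτ, sq])

theorem phi_axis (hu : IsSchwarzschildFGaugeOn m ρ₀ u) (hρ₀ : 0 < ρ₀) :
    ∀ τ ∈ Ioo (-1 : ℝ) 1, u.phi τ 0 = -6 * m := fun τ hτ => by
  simpa using eq_quintic_of_hasDerivAt (-6 * m) 0 0 0 0 0
    (fun τ hτ => hasDerivAt_axis hρ₀ hu.smooth_phi hτ (hu.prop_phi τ hτ))
    (fun τ hτ => by simp [hu.Kt_axis hρ₀ τ hτ]) (hu.init_phi 0 (zero_mem_Ioo_neg hρ₀)) τ hτ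

theorem P_axis (hu : IsSchwarzschildFGaugeOn m ρ₀ u) (hρ₀ : 0 < ρ₀) :
    ∀ τ ∈ Ioo (-1 : ℝ) 1, u.P τ 0 = 0 := fun τ hτ => by
  simpa using eq_quintic_of_hasDerivAt 0 0 0 0 0 0
    (fun τ hτ => hasDerivAt_axis hρ₀ hu.smooth_P hτ (hu.prop_P τ hτ))
    (fun τ hτ => by simp [hu.Kr_axis hρ₀ τ hτ, radialOneForm_axis])
    (hu.init_P 0 (zero_mem_Ioo_neg hρ₀)) τ hτ

theorem f_axis (hu : IsSchwarzschildFGaugeOn m ρ₀ u) (hρ₀ : 0 < ρ₀) :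
    ∀ τ ∈ Ioo (-1 : ℝ) 1, u.f τ 0 = 1 := fun τ hτ => by
  simpa using eq_quintic_of_hasDerivAt 1 0 0 0 0 0
    (fun τ hτ => hasDerivAt_axis hρ₀ hu.smooth_f hτ (hu.prop_f τ hτ))
    (fun τ hτ => by simp [hu.Kr_axis hρ₀ τ hτ, hu.P_axis hρ₀ τ hτ])
    (hu.init_f 0 (zero_mem_Ioo_neg hρ₀)) τ hτ

theorem x_axis (hu : IsSchwarzschildFGaugeOn m ρ₀ u) (hρ₀ : 0 < ρ₀) :
    ∀ τ ∈ Ioo (-1 : ℝ) 1, u.x τ 0 = 0 := fun τ hτ => by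
  simpa using eq_quintic_of_hasDerivAt 0 0 0 0 0 0
    (fun τ hτ => hasDerivAt_axis hρ₀ hu.smooth_x hτ (hu.prop_x τ hτ))
    (fun τ hτ => by simp [hu.Kr_axis hρ₀ τ hτ, hu.Kt_axis hρ₀ τ hτ, hu.P_axis hρ₀ τ hτ])
    (hu.init_x 0 (zero_mem_Ioo_neg hρ₀)) τ hτ

theorem c_axis (hu : IsSchwarzschildFGaugeOn m ρ₀ u) (hρ₀ : 0 < ρ₀) :
    ∀ τ ∈ Ioo (-1 : ℝ) 1, u.c τ 0 = 1 := fun τ hτ => by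
  simpa using eq_quintic_of_hasDerivAt 1 0 0 0 0 0
    (fun τ hτ => hasDerivAt_axis hρ₀ hu.smooth_c hτ (hu.prop_c τ hτ))
    (fun τ hτ => by simp [hu.Kt_axis hρ₀ τ hτ]) (hu.init_c 0 (zero_mem_Ioo_neg hρ₀)) τ hτ

theorem c1_axis (hu : IsSchwarzschildFGaugeOn m ρ₀ u) (hρ₀ : 0 < ρ₀) :
    ∀ τ ∈ Ioo (-1 : ℝ) 1, u.c1 τ 0 = 0 := fun τ hτ => by
  simpa using eq_quintic_of_hasDerivAt 0 0 0 0 0 0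
    (fun τ hτ => hasDerivAt_axis hρ₀ hu.smooth_c1 hτ (hu.prop_c1 τ hτ))
    (fun τ hτ => by simp [hu.Kr_axis hρ₀ τ hτ]) (hu.init_c1 0 (zero_mem_Ioo_neg hρ₀)) τ hτ

theorem c0_axis (hu : IsSchwarzschildFGaugeOn m ρ₀ u) (hρ₀ : 0 < ρ₀) :
    ∀ τ ∈ Ioo (-1 : ℝ) 1, u.c0 τ 0 = -τ := fun τ hτ => by
  simpa using eq_quintic_of_hasDerivAt 0 (-1) 0 0 0 0
    (fun τ hτ => hasDerivAt_axis hρ₀ hu.smooth_c0 hτ (hu.prop_c0 τ hτ))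
    (fun τ hτ => by simp [hu.Kr_axis hρ₀ τ hτ, hu.f_axis hρ₀ τ hτ])
    (hu.init_c0 0 (zero_mem_Ioo_neg hρ₀)) τ hτ

/-- Every smooth background field is differentiable in `ρ` on the cylinder, with derivative its
first Taylor coefficient. -/
theorem hasDerivAt_field (hρ₀ : 0 < ρ₀) {G : ℝ → ℝ → ℝ}
    (hG : ContDiffOn ℝ ∞ (Function.uncurry G) (Ioo (-1) 1 ×ˢ Ioo (-ρ₀) ρ₀)) {τ : ℝ}
    (hτ : τ ∈ Ioo (-1 : ℝ) 1) : HasDerivAt (fun ρ => G τ ρ) (realJet G 1 τ) 0 :=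
  hasDerivAt_radial isOpen_Ioo isOpen_Ioo (zero_mem_Ioo_neg hρ₀) hG hτ

theorem Lr_jet (hu : IsSchwarzschildFGaugeOn m ρ₀ u) (hρ₀ : 0 < ρ₀) :
    ∀ τ ∈ Ioo (-1 : ℝ) 1, realJet u.Lr 1 τ = 2 * m * (1 - τ ^ 2) := fun τ hτ => by
  rw [eq_quintic_of_hasDerivAt (2 * m) 0 (-2 * m) 0 0 0
    (fun τ hτ => hasDerivAt_realJet_one hρ₀ hu.smooth_Lr hτ (hu.prop_Lr τ hτ)
      (((hasDerivAt_field hρ₀ hu.smooth_Kr hτ).fun_mul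
        (hasDerivAt_field hρ₀ hu.smooth_Lr hτ)).fun_neg.fun_sub
        (((hasDerivAt_deriv_conformalFactor_radial m τ).fun_mul
          (hasDerivAt_field hρ₀ hu.smooth_phi hτ)).div_const 3)))
    (fun τ hτ => by
      simp only [hu.Kr_axis hρ₀ τ hτ, hu.Lr_axis hρ₀ τ hτ, hu.phi_axis hρ₀ τ hτ,
        deriv_conformalFactor_axis]
      ring)
    (realJet_one_of_eq hρ₀ hu.init_Lr
      (((hasDerivAt_conformalFactor_radial m 0).const_mul (2 * m)).congr_deriv (by ring))) τ hτ]
  ring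

theorem Lt_jet (hu : IsSchwarzschildFGaugeOn m ρ₀ u) (hρ₀ : 0 < ρ₀) :
    ∀ τ ∈ Ioo (-1 : ℝ) 1, realJet u.Lt 1 τ = -m * (1 - τ ^ 2) := fun τ hτ => by
  rw [eq_quintic_of_hasDerivAt (-m) 0 m 0 0 0
    (fun τ hτ => hasDerivAt_realJet_one hρ₀ hu.smooth_Lt hτ (hu.prop_Lt τ hτ)
      (((hasDerivAt_field hρ₀ hu.smooth_Kt hτ).fun_mul
        (hasDerivAt_field hρ₀ hu.smooth_Lt hτ)).fun_neg.fun_add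
        (((hasDerivAt_deriv_conformalFactor_radial m τ).fun_mul
          (hasDerivAt_field hρ₀ hu.smooth_phi hτ)).div_const 6)))
    (fun τ hτ => by
      simp only [hu.Kt_axis hρ₀ τ hτ, hu.Lt_axis hρ₀ τ hτ, hu.phi_axis hρ₀ τ hτ,
        deriv_conformalFactor_axis]
      ring)
    (realJet_one_of_eq hρ₀ hu.init_Lt
      (((hasDerivAt_conformalFactor_radial m 0).const_mul m).fun_neg.congr_deriv (by ring))) τ hτ]
  ring

theorem Kr_jet (hu : IsSchwarzschildFGaugeOn m ρ₀ u) (hρ₀ : 0 < ρ₀) :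
    ∀ τ ∈ Ioo (-1 : ℝ) 1, realJet u.Kr 1 τ = 4 * m * (τ - τ ^ 3 / 3) := fun τ hτ => by
  rw [eq_quintic_of_hasDerivAt 0 (4 * m) 0 (-4 * m / 3) 0 0
    (fun τ hτ => hasDerivAt_realJet_one hρ₀ hu.smooth_Kr hτ (hu.prop_Kr τ hτ)
      ((((hasDerivAt_field hρ₀ hu.smooth_Kr hτ).fun_pow 2).fun_neg.fun_add
        (hasDerivAt_field hρ₀ hu.smooth_Lr hτ)).fun_sub
        (((hasDerivAt_conformalFactor_radial m τ).fun_mul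
          (hasDerivAt_field hρ₀ hu.smooth_phi hτ)).div_const 3)))
    (fun τ hτ => by
      simp only [hu.Kr_axis hρ₀ τ hτ, hu.Lr_jet hρ₀ τ hτ, hu.phi_axis hρ₀ τ hτ,
        conformalFactor_axis]
      ring)
    (realJet_one_of_eq hρ₀ hu.init_Kr (hasDerivAt_const _ _)) τ hτ]
  ring

theorem Kt_jet (hu : IsSchwarzschildFGaugeOn m ρ₀ u) (hρ₀ : 0 < ρ₀) :
    ∀ τ ∈ Ioo (-1 : ℝ) 1, realJet u.Kt 1 τ = -2 * m * (τ - τ ^ 3 / 3) := fun τ hτ => by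
  rw [eq_quintic_of_hasDerivAt 0 (-2 * m) 0 (2 * m / 3) 0 0
    (fun τ hτ => hasDerivAt_realJet_one hρ₀ hu.smooth_Kt hτ (hu.prop_Kt τ hτ)
      ((((hasDerivAt_field hρ₀ hu.smooth_Kt hτ).fun_pow 2).fun_neg.fun_add
        (hasDerivAt_field hρ₀ hu.smooth_Lt hτ)).fun_add
        (((hasDerivAt_conformalFactor_radial m τ).fun_mul
          (hasDerivAt_field hρ₀ hu.smooth_phi hτ)).div_const 6)))
    (fun τ hτ => by
      simp only [hu.Kt_axis hρ₀ τ hτ, hu.Lt_jet hρ₀ τ hτ, hu.phi_axis hρ₀ τ hτ,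
        conformalFactor_axis]
      ring)
    (realJet_one_of_eq hρ₀ hu.init_Kt (hasDerivAt_const _ _)) τ hτ]
  ring

theorem P_jet (hu : IsSchwarzschildFGaugeOn m ρ₀ u) (hρ₀ : 0 < ρ₀) :
    ∀ τ ∈ Ioo (-1 : ℝ) 1, realJet u.P 1 τ = 4 * m * τ := fun τ hτ => by
  rw [eq_quintic_of_hasDerivAt 0 (4 * m) 0 0 0 0
    (fun τ hτ => hasDerivAt_realJet_one hρ₀ hu.smooth_P hτ (hu.prop_P τ hτ)
      (((hasDerivAt_field hρ₀ hu.smooth_Kr hτ).fun_mul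
        (hasDerivAt_field hρ₀ hu.smooth_P hτ)).fun_neg.fun_sub
        (((hasDerivAt_radialOneForm m).fun_mul
          (hasDerivAt_field hρ₀ hu.smooth_phi hτ)).div_const 3)))
    (fun τ hτ => by
      simp only [hu.Kr_axis hρ₀ τ hτ, hu.P_axis hρ₀ τ hτ, hu.phi_axis hρ₀ τ hτ,
        radialOneForm_axis]
      ring)
    (realJet_one_of_eq hρ₀ hu.init_P (hasDerivAt_const _ _)) τ hτ]
  ring

theorem f_jet (hu : IsSchwarzschildFGaugeOn m ρ₀ u) (hρ₀ : 0 < ρ₀) :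
    ∀ τ ∈ Ioo (-1 : ℝ) 1, realJet u.f 1 τ = m * τ ^ 4 / 3 := fun τ hτ => by
  rw [eq_quintic_of_hasDerivAt 0 0 0 0 (m / 3) 0
    (fun τ hτ => hasDerivAt_realJet_one hρ₀ hu.smooth_f hτ (hu.prop_f τ hτ)
      (((hasDerivAt_field hρ₀ hu.smooth_Kr hτ).fun_mul
        (hasDerivAt_field hρ₀ hu.smooth_f hτ)).fun_neg.fun_add
        (hasDerivAt_field hρ₀ hu.smooth_P hτ)))
    (fun τ hτ => by
      simp only [hu.Kr_axis hρ₀ τ hτ, hu.f_axis hρ₀ τ hτ, hu.Kr_jet hρ₀ τ hτ, hu.P_jet hρ₀ τ hτ]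
      ring)
    (realJet_one_of_eq hρ₀ hu.init_f (hasDerivAt_const _ _)) τ hτ]
  ring

theorem x_jet (hu : IsSchwarzschildFGaugeOn m ρ₀ u) (hρ₀ : 0 < ρ₀) :
    ∀ τ ∈ Ioo (-1 : ℝ) 1, realJet u.x 1 τ = m * (τ ^ 2 - τ ^ 4 / 2) := fun τ hτ => by
  rw [eq_quintic_of_hasDerivAt 0 0 m 0 (-m / 2) 0
    (fun τ hτ => hasDerivAt_realJet_one hρ₀ hu.smooth_x hτ (hu.prop_x τ hτ)
      ((((hasDerivAt_field hρ₀ hu.smooth_Kt hτ).fun_mul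
        (hasDerivAt_field hρ₀ hu.smooth_x hτ)).fun_neg.fun_add
        (((hasDerivAt_field hρ₀ hu.smooth_Kr hτ).fun_sub
          (hasDerivAt_field hρ₀ hu.smooth_Kt hτ)).fun_mul
          (hasDerivAt_field hρ₀ hu.smooth_f hτ))).fun_sub (hasDerivAt_field hρ₀ hu.smooth_P hτ)))
    (fun τ hτ => by
      simp only [hu.Kr_axis hρ₀ τ hτ, hu.Kt_axis hρ₀ τ hτ, hu.x_axis hρ₀ τ hτ,
        hu.f_axis hρ₀ τ hτ, hu.Kr_jet hρ₀ τ hτ, hu.Kt_jet hρ₀ τ hτ, hu.P_jet hρ₀ τ hτ]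
      ring)
    (realJet_one_of_eq hρ₀ hu.init_x (hasDerivAt_const _ _)) τ hτ]
  ring

theorem c_jet (hu : IsSchwarzschildFGaugeOn m ρ₀ u) (hρ₀ : 0 < ρ₀) :
    ∀ τ ∈ Ioo (-1 : ℝ) 1, realJet u.c 1 τ = m * (τ ^ 2 - τ ^ 4 / 6) := fun τ hτ => by
  rw [eq_quintic_of_hasDerivAt 0 0 m 0 (-m / 6) 0
    (fun τ hτ => hasDerivAt_realJet_one hρ₀ hu.smooth_c hτ (hu.prop_c τ hτ)
      ((hasDerivAt_field hρ₀ hu.smooth_Kt hτ).fun_mul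
        (hasDerivAt_field hρ₀ hu.smooth_c hτ)).fun_neg)
    (fun τ hτ => by
      simp only [hu.Kt_axis hρ₀ τ hτ, hu.c_axis hρ₀ τ hτ, hu.Kt_jet hρ₀ τ hτ]
      ring)
    (realJet_one_of_eq hρ₀ hu.init_c (hasDerivAt_const _ _)) τ hτ]
  ring

theorem c0_jet (hu : IsSchwarzschildFGaugeOn m ρ₀ u) (hρ₀ : 0 < ρ₀) :
    ∀ τ ∈ Ioo (-1 : ℝ) 1,
      realJet u.c0 1 τ = m * (4 * τ ^ 3 / 3 - τ ^ 5 / 3) := fun τ hτ => by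
  rw [eq_quintic_of_hasDerivAt 0 0 0 (4 * m / 3) 0 (-m / 3)
    (fun τ hτ => hasDerivAt_realJet_one hρ₀ hu.smooth_c0 hτ (hu.prop_c0 τ hτ)
      (((hasDerivAt_field hρ₀ hu.smooth_Kr hτ).fun_mul
        (hasDerivAt_field hρ₀ hu.smooth_c0 hτ)).fun_neg.fun_sub
        (hasDerivAt_field hρ₀ hu.smooth_f hτ)))
    (fun τ hτ => by
      simp only [hu.Kr_axis hρ₀ τ hτ, hu.c0_axis hρ₀ τ hτ, hu.Kr_jet hρ₀ τ hτ, hu.f_jet hρ₀ τ hτ]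
      ring)
    (realJet_one_of_eq hρ₀ hu.init_c0 (hasDerivAt_const _ _)) τ hτ]
  ring

theorem c1_jet (hu : IsSchwarzschildFGaugeOn m ρ₀ u) (hρ₀ : 0 < ρ₀) :
    ∀ τ ∈ Ioo (-1 : ℝ) 1, realJet u.c1 1 τ = 1 := fun τ hτ => by
  rw [eq_quintic_of_hasDerivAt 1 0 0 0 0 0
    (fun τ hτ => hasDerivAt_realJet_one hρ₀ hu.smooth_c1 hτ (hu.prop_c1 τ hτ)
      ((hasDerivAt_field hρ₀ hu.smooth_Kr hτ).fun_mul
        (hasDerivAt_field hρ₀ hu.smooth_c1 hτ)).fun_neg)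
    (fun τ hτ => by
      simp only [hu.Kr_axis hρ₀ τ hτ, hu.c1_axis hρ₀ τ hτ]
      ring)
    (realJet_one_of_eq hρ₀ hu.init_c1 (hasDerivAt_id' _)) τ hτ]
  ring

/-- The radial frame component is needed to second order, since it vanishes on the cylinder. -/
theorem c1_jet_two (hu : IsSchwarzschildFGaugeOn m ρ₀ u) (hρ₀ : 0 < ρ₀) :
    ∀ τ ∈ Ioo (-1 : ℝ) 1,
      realJet u.c1 2 τ = -m * (4 * τ ^ 2 - 2 * τ ^ 4 / 3) := fun τ hτ => by
  rw [eq_quintic_of_hasDerivAt 0 0 (-4 * m) 0 (2 * m / 3) 0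
    (fun τ hτ => hasDerivAt_realJet_of_deriv_eq hρ₀ hu.smooth_c1 hτ (hu.prop_c1 τ hτ) 2)
    (fun τ hτ => by
      have h0 := zero_mem_Ioo_neg hρ₀
      have hK := contDiffAt_radial isOpen_Ioo isOpen_Ioo h0 hu.smooth_Kr hτ
      have hc := contDiffAt_radial isOpen_Ioo isOpen_Ioo h0 hu.smooth_c1 hτ
      have h2 : (2 : WithTop ℕ∞) ≤ ∞ := ENat.LEInfty.out
      have e1 : deriv (u.Kr τ) 0 = realJet u.Kr 1 τ := by simp [realJet]
      have e2 : deriv (u.c1 τ) 0 = realJet u.c1 1 τ := by simp [realJet]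
      rw [iteratedDeriv_fun_neg, iteratedDeriv_fun_mul (hK.of_le h2) (hc.of_le h2)]
      simp only [Finset.sum_range_succ, Finset.sum_range_zero, iteratedDeriv_zero,
        Nat.sub_zero, Nat.sub_self, Nat.reduceSub, hu.Kr_axis hρ₀ τ hτ, hu.c1_axis hρ₀ τ hτ,
        iteratedDeriv_one, e1, e2, hu.Kr_jet hρ₀ τ hτ, hu.c1_jet hρ₀ τ hτ]
      norm_num
      ring)
    ((realJet_eq_of_eq hρ₀ hu.init_c1 2).trans (by simp [iteratedDeriv_succ'])) τ hτ]
  ring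

end IsSchwarzschildFGaugeOn

/-! ### The background coefficients of the transport equations -/

namespace IsSchwarzschildFGaugeOn

variable {m ρ₀ : ℝ} {u : FGaugeFields}

theorem rhoJet_zero (g : ℝ → ℝ → ℝ) (τ : ℝ) : rhoJet g 0 τ = (g τ 0 : ℂ) := by
  simp [rhoJet]

theorem rhoJet_c1_one (hu : IsSchwarzschildFGaugeOn m ρ₀ u) (hρ₀ : 0 < ρ₀) {τ : ℝ}
    (hτ : τ ∈ Ioo (-1 : ℝ) 1) : rhoJet u.c1 1 τ = 1 := by
  exact (congrArg Complex.ofReal (hu.c1_jet hρ₀ τ hτ)).trans (by simp)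

theorem rhoJet_c1_two (hu : IsSchwarzschildFGaugeOn m ρ₀ u) (hρ₀ : 0 < ρ₀) {τ : ℝ}
    (hτ : τ ∈ Ioo (-1 : ℝ) 1) :
    rhoJet u.c1 2 τ = -(m : ℂ) * (4 * (τ : ℂ) ^ 2 - 2 * (τ : ℂ) ^ 4 / 3) := by
  exact (congrArg Complex.ofReal (hu.c1_jet_two hρ₀ τ hτ)).trans (by push_cast; ring)

theorem rhoJet_c_one (hu : IsSchwarzschildFGaugeOn m ρ₀ u) (hρ₀ : 0 < ρ₀) {τ : ℝ}
    (hτ : τ ∈ Ioo (-1 : ℝ) 1) :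
    rhoJet u.c 1 τ = (m : ℂ) * ((τ : ℂ) ^ 2 - (τ : ℂ) ^ 4 / 6) := by
  exact (congrArg Complex.ofReal (hu.c_jet hρ₀ τ hτ)).trans (by push_cast; ring)

theorem rhoJet_c0_one (hu : IsSchwarzschildFGaugeOn m ρ₀ u) (hρ₀ : 0 < ρ₀) {τ : ℝ}
    (hτ : τ ∈ Ioo (-1 : ℝ) 1) :
    rhoJet u.c0 1 τ = (m : ℂ) * (4 * (τ : ℂ) ^ 3 / 3 - (τ : ℂ) ^ 5 / 3) := by
  exact (congrArg Complex.ofReal (hu.c0_jet hρ₀ τ hτ)).trans (by push_cast; ring)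

theorem rhoJet_Kt_one (hu : IsSchwarzschildFGaugeOn m ρ₀ u) (hρ₀ : 0 < ρ₀) {τ : ℝ}
    (hτ : τ ∈ Ioo (-1 : ℝ) 1) :
    rhoJet u.Kt 1 τ = -2 * (m : ℂ) * ((τ : ℂ) - (τ : ℂ) ^ 3 / 3) := by
  exact (congrArg Complex.ofReal (hu.Kt_jet hρ₀ τ hτ)).trans (by push_cast; ring)

theorem rhoJet_x_one (hu : IsSchwarzschildFGaugeOn m ρ₀ u) (hρ₀ : 0 < ρ₀) {τ : ℝ}
    (hτ : τ ∈ Ioo (-1 : ℝ) 1) :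
    rhoJet u.x 1 τ = (m : ℂ) * ((τ : ℂ) ^ 2 - (τ : ℂ) ^ 4 / 2) := by
  exact (congrArg Complex.ofReal (hu.x_jet hρ₀ τ hτ)).trans (by push_cast; ring)

theorem rhoJet_one_of_hasDerivAt {g : ℝ → ℝ → ℝ} {τ d : ℝ} (h : HasDerivAt (fun ρ => g τ ρ) d 0) :
    rhoJet g 1 τ = (d : ℂ) := by
  simp [rhoJet, h.deriv]

theorem rhoJet_one_sub_c0_one (hu : IsSchwarzschildFGaugeOn m ρ₀ u) (hρ₀ : 0 < ρ₀) {τ : ℝ}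
    (hτ : τ ∈ Ioo (-1 : ℝ) 1) :
    rhoJet (fun t ρ => 1 - u.c0 t ρ) 1 τ =
      -((m : ℂ) * (4 * (τ : ℂ) ^ 3 / 3 - (τ : ℂ) ^ 5 / 3)) := by
  rw [rhoJet_one_of_hasDerivAt ((hasDerivAt_field hρ₀ hu.smooth_c0 hτ).const_sub 1),
    hu.c0_jet hρ₀ τ hτ]
  push_cast
  ring

theorem rhoJet_one_add_c0_one (hu : IsSchwarzschildFGaugeOn m ρ₀ u) (hρ₀ : 0 < ρ₀) {τ : ℝ}
    (hτ : τ ∈ Ioo (-1 : ℝ) 1) :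
    rhoJet (fun t ρ => 1 + u.c0 t ρ) 1 τ =
      (m : ℂ) * (4 * (τ : ℂ) ^ 3 / 3 - (τ : ℂ) ^ 5 / 3) := by
  rw [rhoJet_one_of_hasDerivAt ((hasDerivAt_field hρ₀ hu.smooth_c0 hτ).const_add 1),
    hu.c0_jet hρ₀ τ hτ]
  push_cast
  ring

theorem rhoJet_rhs_zero_one (hu : IsSchwarzschildFGaugeOn m ρ₀ u) (hρ₀ : 0 < ρ₀) {τ : ℝ}
    (hτ : τ ∈ Ioo (-1 : ℝ) 1) :
    rhoJet (fun t ρ => u.x t ρ - u.f t ρ - u.Kr t ρ - u.Kt t ρ) 1 τ =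
      (m : ℂ) * (-2 * (τ : ℂ) + (τ : ℂ) ^ 2 + 2 * (τ : ℂ) ^ 3 / 3 - 5 * (τ : ℂ) ^ 4 / 6) := by
  rw [rhoJet_one_of_hasDerivAt ((((hasDerivAt_field hρ₀ hu.smooth_x hτ).fun_sub
    (hasDerivAt_field hρ₀ hu.smooth_f hτ)).fun_sub (hasDerivAt_field hρ₀ hu.smooth_Kr hτ)).fun_sub
    (hasDerivAt_field hρ₀ hu.smooth_Kt hτ)), hu.x_jet hρ₀ τ hτ, hu.f_jet hρ₀ τ hτ,
    hu.Kr_jet hρ₀ τ hτ, hu.Kt_jet hρ₀ τ hτ]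
  push_cast
  ring

theorem rhoJet_rhs_two_one (hu : IsSchwarzschildFGaugeOn m ρ₀ u) (hρ₀ : 0 < ρ₀) {τ : ℝ}
    (hτ : τ ∈ Ioo (-1 : ℝ) 1) :
    rhoJet (fun t ρ => u.f t ρ - u.x t ρ - u.Kr t ρ - u.Kt t ρ) 1 τ =
      (m : ℂ) * (-2 * (τ : ℂ) - (τ : ℂ) ^ 2 + 2 * (τ : ℂ) ^ 3 / 3 + 5 * (τ : ℂ) ^ 4 / 6) := by
  rw [rhoJet_one_of_hasDerivAt ((((hasDerivAt_field hρ₀ hu.smooth_f hτ).fun_sub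
    (hasDerivAt_field hρ₀ hu.smooth_x hτ)).fun_sub (hasDerivAt_field hρ₀ hu.smooth_Kr hτ)).fun_sub
    (hasDerivAt_field hρ₀ hu.smooth_Kt hτ)), hu.x_jet hρ₀ τ hτ, hu.f_jet hρ₀ τ hτ,
    hu.Kr_jet hρ₀ τ hτ, hu.Kt_jet hρ₀ τ hτ]
  push_cast
  ring

end IsSchwarzschildFGaugeOn

/-! ### The transport equations when all but the last two orders vanish -/

/-- A Leibniz sum whose terms beyond the second derivative vanish. The values of the terms `1` and
`2` are only required where the binomial coefficients do not vanish. -/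
theorem sum_choose_mul_eq {n : ℕ} {F : ℕ → ℂ} {x₀ x₁ x₂ : ℂ} (h0 : F 0 = x₀)
    (h1 : 1 ≤ n → F 1 = x₁) (h2 : 2 ≤ n → F 2 = x₂) (h3 : ∀ i, 3 ≤ i → i ≤ n → F i = 0) :
    ∑ i ∈ Finset.range (n + 1), (n.choose i : ℂ) * F i =
      x₀ + n * x₁ + (n.choose 2 : ℂ) * x₂ := by
  rcases n with _ | _ | n
  · simp [h0]
  · simp [Finset.sum_range_succ, h0, h1 le_rfl]
  · have hsub : Finset.range 3 ⊆ Finset.range (n + 2 + 1) :=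
      Finset.range_subset_range.mpr (by omega)
    rw [← Finset.sum_subset hsub fun i hi hi' => ?_]
    · simp [Finset.sum_range_succ, h0, h1 (by omega), h2 (by omega)]
    · rw [Finset.mem_range] at hi hi'
      rw [h3 i (by omega) (by omega), mul_zero]

section Transport

open IsSchwarzschildFGaugeOn

variable {m ρ₀ : ℝ} {u : FGaugeFields} {a : Fin 3 → ℕ → ℕ → ℕ → ℝ → ℂ} {n q k : ℕ}

theorem deriv_eq_zero_of_vanish {y : ℝ → ℂ} (hy : ∀ τ ∈ Ioo (-1 : ℝ) 1, y τ = 0) {τ : ℝ}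
    (hτ : τ ∈ Ioo (-1 : ℝ) 1) : deriv y τ = 0 := by
  have e : y =ᶠ[nhds τ] fun _ => 0 := by
    filter_upwards [isOpen_Ioo.mem_nhds hτ] with t ht using hy t ht
  rw [e.deriv_eq, deriv_const]

/-- If all orders below `n - 1` vanish, the background enters only through its first `ρ`-derivative,
except for the second derivative of `c¹`, and the order `n - 1` acts as a source for the order `n`.
For `n = 0` the truncated `n - 1` appears with a vanishing coefficient. -/
theorem MaxwellTransport.propagation_zero_reduced (hu : IsSchwarzschildFGaugeOn m ρ₀ u)
    (hρ₀ : 0 < ρ₀) (h : MaxwellTransport u a n q k)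
    (hz : ∀ j : Fin 3, ∀ l, l + 1 < n → ∀ τ ∈ Ioo (-1 : ℝ) 1, a j l q k τ = 0) {τ : ℝ}
    (hτ : τ ∈ Ioo (-1 : ℝ) 1) :
    (1 + τ) * deriv (a 0 n q k) τ = (n - 1) * a 0 n q k τ - modeFactor q * a 1 n q k τ
      + (n * (m * (4 * τ ^ 3 / 3 - τ ^ 5 / 3) * deriv (a 0 (n - 1) q k) τ
          - modeFactor q * (m * (τ ^ 2 - τ ^ 4 / 6)) * a 1 (n - 1) q k τ
          + m * (-2 * τ + τ ^ 2 + 2 * τ ^ 3 / 3 - 5 * τ ^ 4 / 6) * a 0 (n - 1) q k τ)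
        - n.choose 2 * (m * (4 * τ ^ 2 - 2 * τ ^ 4 / 3)) * a 0 (n - 1) q k τ) := by
  have hz' : ∀ j : Fin 3, ∀ l, l + 1 < n → a j l q k τ = 0 := fun j l hl => hz j l hl τ hτ
  have hd : ∀ j : Fin 3, ∀ l, l + 1 < n → deriv (a j l q k) τ = 0 := fun j l hl =>
    deriv_eq_zero_of_vanish (hz j l hl) hτ
  have h' := h.propagation_zero τ hτ
  rw [sum_choose_mul_eq (x₀ := (1 + τ) * deriv (a 0 n q k) τ + modeFactor q * a 1 n q k τ)
      (x₁ := -(m * (4 * τ ^ 3 / 3 - τ ^ 5 / 3)) * deriv (a 0 (n - 1) q k) τ - a 0 n q k τ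
        + modeFactor q * (m * (τ ^ 2 - τ ^ 4 / 6)) * a 1 (n - 1) q k τ)
      (x₂ := m * (4 * τ ^ 2 - 2 * τ ^ 4 / 3) * a 0 (n - 1) q k τ),
    sum_choose_mul_eq (x₀ := -a 0 n q k τ)
      (x₁ := m * (-2 * τ + τ ^ 2 + 2 * τ ^ 3 / 3 - 5 * τ ^ 4 / 6) * a 0 (n - 1) q k τ)
      (x₂ := 0)] at h'
  · linear_combination h'
  · simp [rhoJet_zero, hu.x_axis hρ₀ τ hτ, hu.f_axis hρ₀ τ hτ, hu.Kr_axis hρ₀ τ hτ,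
      hu.Kt_axis hρ₀ τ hτ]
  · intro _
    rw [hu.rhoJet_rhs_zero_one hρ₀ hτ]
  · intro hn
    rw [hz' 0 (n - 2) (by omega), mul_zero]
  · intro i hi hin
    rw [hz' 0 (n - i) (by omega), mul_zero]
  · simp [rhoJet_zero, hu.c0_axis hρ₀ τ hτ, hu.c1_axis hρ₀ τ hτ, hu.c_axis hρ₀ τ hτ]
  · intro hn
    rw [hu.rhoJet_one_sub_c0_one hρ₀ hτ, hu.rhoJet_c1_one hρ₀ hτ, hu.rhoJet_c_one hρ₀ hτ,
      Nat.sub_add_cancel hn]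
    ring
  · intro hn
    rw [hd 0 (n - 2) (by omega), hz' 1 (n - 2) (by omega), hu.rhoJet_c1_two hρ₀ hτ,
      show n - 2 + 1 = n - 1 by omega]
    ring
  · intro i hi hin
    rw [hd 0 (n - i) (by omega), hz' 1 (n - i) (by omega), hz' 0 (n - i + 1) (by omega)]
    ring

theorem MaxwellTransport.propagation_one_reduced (hu : IsSchwarzschildFGaugeOn m ρ₀ u)
    (hρ₀ : 0 < ρ₀) (h : MaxwellTransport u a n q k)
    (hz : ∀ j : Fin 3, ∀ l, l + 1 < n → ∀ τ ∈ Ioo (-1 : ℝ) 1, a j l q k τ = 0) {τ : ℝ}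
    (hτ : τ ∈ Ioo (-1 : ℝ) 1) :
    deriv (a 1 n q k) τ = 1 / 2 * modeFactor q * (a 0 n q k τ - a 2 n q k τ)
      + n * (1 / 2 * modeFactor q * (m * (τ ^ 2 - τ ^ 4 / 6))
            * (a 0 (n - 1) q k τ - a 2 (n - 1) q k τ)
          + 4 * m * (τ - τ ^ 3 / 3) * a 1 (n - 1) q k τ) := by
  have hz' : ∀ j : Fin 3, ∀ l, l + 1 < n → a j l q k τ = 0 := fun j l hl => hz j l hl τ hτ
  have h' := h.propagation_one τ hτ
  rw [sum_choose_mul_eq (x₀ := 1 / 2 * modeFactor q * (a 2 n q k τ - a 0 n q k τ))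
      (x₁ := 1 / 2 * modeFactor q * (m * (τ ^ 2 - τ ^ 4 / 6))
        * (a 2 (n - 1) q k τ - a 0 (n - 1) q k τ)) (x₂ := 0),
    sum_choose_mul_eq (x₀ := 0) (x₁ := 4 * m * (τ - τ ^ 3 / 3) * a 1 (n - 1) q k τ)
      (x₂ := 0)] at h'
  · linear_combination h'
  · simp [rhoJet_zero, hu.Kt_axis hρ₀ τ hτ]
  · intro _
    rw [hu.rhoJet_Kt_one hρ₀ hτ]
    ring
  · intro hn
    rw [hz' 1 (n - 2) (by omega), mul_zero]
  · intro i hi hin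
    rw [hz' 1 (n - i) (by omega), mul_zero]
  · simp [rhoJet_zero, hu.c_axis hρ₀ τ hτ]
  · intro _
    rw [hu.rhoJet_c_one hρ₀ hτ]
  · intro hn
    rw [hz' 2 (n - 2) (by omega), hz' 0 (n - 2) (by omega), sub_zero, mul_zero]
  · intro i hi hin
    rw [hz' 2 (n - i) (by omega), hz' 0 (n - i) (by omega), sub_zero, mul_zero]

theorem MaxwellTransport.propagation_two_reduced (hu : IsSchwarzschildFGaugeOn m ρ₀ u)
    (hρ₀ : 0 < ρ₀) (h : MaxwellTransport u a n q k)
    (hz : ∀ j : Fin 3, ∀ l, l + 1 < n → ∀ τ ∈ Ioo (-1 : ℝ) 1, a j l q k τ = 0) {τ : ℝ}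
    (hτ : τ ∈ Ioo (-1 : ℝ) 1) :
    (1 - τ) * deriv (a 2 n q k) τ = -(n - 1) * a 2 n q k τ + modeFactor q * a 1 n q k τ
      + (n * (-(m * (4 * τ ^ 3 / 3 - τ ^ 5 / 3)) * deriv (a 2 (n - 1) q k) τ
          + modeFactor q * (m * (τ ^ 2 - τ ^ 4 / 6)) * a 1 (n - 1) q k τ
          + m * (-2 * τ - τ ^ 2 + 2 * τ ^ 3 / 3 + 5 * τ ^ 4 / 6) * a 2 (n - 1) q k τ)
        + n.choose 2 * (m * (4 * τ ^ 2 - 2 * τ ^ 4 / 3)) * a 2 (n - 1) q k τ) := by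
  have hz' : ∀ j : Fin 3, ∀ l, l + 1 < n → a j l q k τ = 0 := fun j l hl => hz j l hl τ hτ
  have hd : ∀ j : Fin 3, ∀ l, l + 1 < n → deriv (a j l q k) τ = 0 := fun j l hl =>
    deriv_eq_zero_of_vanish (hz j l hl) hτ
  have h' := h.propagation_two τ hτ
  rw [sum_choose_mul_eq (x₀ := (1 - τ) * deriv (a 2 n q k) τ - modeFactor q * a 1 n q k τ)
      (x₁ := m * (4 * τ ^ 3 / 3 - τ ^ 5 / 3) * deriv (a 2 (n - 1) q k) τ + a 2 n q k τ
        - modeFactor q * (m * (τ ^ 2 - τ ^ 4 / 6)) * a 1 (n - 1) q k τ)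
      (x₂ := -(m * (4 * τ ^ 2 - 2 * τ ^ 4 / 3)) * a 2 (n - 1) q k τ),
    sum_choose_mul_eq (x₀ := a 2 n q k τ)
      (x₁ := m * (-2 * τ - τ ^ 2 + 2 * τ ^ 3 / 3 + 5 * τ ^ 4 / 6) * a 2 (n - 1) q k τ)
      (x₂ := 0)] at h'
  · linear_combination h'
  · simp [rhoJet_zero, hu.x_axis hρ₀ τ hτ, hu.f_axis hρ₀ τ hτ, hu.Kr_axis hρ₀ τ hτ,
      hu.Kt_axis hρ₀ τ hτ]
  · intro _
    rw [hu.rhoJet_rhs_two_one hρ₀ hτ]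
  · intro hn
    rw [hz' 2 (n - 2) (by omega), mul_zero]
  · intro i hi hin
    rw [hz' 2 (n - i) (by omega), mul_zero]
  · simp [rhoJet_zero, hu.c0_axis hρ₀ τ hτ, hu.c1_axis hρ₀ τ hτ, hu.c_axis hρ₀ τ hτ,
      ← sub_eq_add_neg]
  · intro hn
    rw [hu.rhoJet_one_add_c0_one hρ₀ hτ, hu.rhoJet_c1_one hρ₀ hτ, hu.rhoJet_c_one hρ₀ hτ,
      Nat.sub_add_cancel hn]
    ring
  · intro hn
    rw [hd 2 (n - 2) (by omega), hz' 1 (n - 2) (by omega), hu.rhoJet_c1_two hρ₀ hτ,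
      show n - 2 + 1 = n - 1 by omega]
    ring
  · intro i hi hin
    rw [hd 2 (n - i) (by omega), hz' 1 (n - i) (by omega), hz' 2 (n - i + 1) (by omega)]
    ring

theorem MaxwellTransport.constraint_reduced (hu : IsSchwarzschildFGaugeOn m ρ₀ u)
    (hρ₀ : 0 < ρ₀) (h : MaxwellTransport u a n q k)
    (hz : ∀ j : Fin 3, ∀ l, l + 1 < n → ∀ τ ∈ Ioo (-1 : ℝ) 1, a j l q k τ = 0) {τ : ℝ}
    (hτ : τ ∈ Ioo (-1 : ℝ) 1) :
    n * a 1 n q k τ - τ * deriv (a 1 n q k) τ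
        - 1 / 2 * modeFactor q * (a 0 n q k τ + a 2 n q k τ) =
      n * (-(m * (4 * τ ^ 3 / 3 - τ ^ 5 / 3)) * deriv (a 1 (n - 1) q k) τ
          + 1 / 2 * modeFactor q * (m * (τ ^ 2 - τ ^ 4 / 6))
            * (a 0 (n - 1) q k τ + a 2 (n - 1) q k τ)
          - 2 * m * (τ ^ 2 - τ ^ 4 / 2) * a 1 (n - 1) q k τ)
        + n.choose 2 * (m * (4 * τ ^ 2 - 2 * τ ^ 4 / 3)) * a 1 (n - 1) q k τ := by
  have hz' : ∀ j : Fin 3, ∀ l, l + 1 < n → a j l q k τ = 0 := fun j l hl => hz j l hl τ hτ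
  have hd : ∀ j : Fin 3, ∀ l, l + 1 < n → deriv (a j l q k) τ = 0 := fun j l hl =>
    deriv_eq_zero_of_vanish (hz j l hl) hτ
  have h' := h.constraint τ hτ
  rw [sum_choose_mul_eq (x₀ := -τ * deriv (a 1 n q k) τ
        - 1 / 2 * modeFactor q * (a 2 n q k τ + a 0 n q k τ))
      (x₁ := m * (4 * τ ^ 3 / 3 - τ ^ 5 / 3) * deriv (a 1 (n - 1) q k) τ + a 1 n q k τ
        - 1 / 2 * modeFactor q * (m * (τ ^ 2 - τ ^ 4 / 6))
          * (a 2 (n - 1) q k τ + a 0 (n - 1) q k τ))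
      (x₂ := -(m * (4 * τ ^ 2 - 2 * τ ^ 4 / 3)) * a 1 (n - 1) q k τ),
    sum_choose_mul_eq (x₀ := 0) (x₁ := -2 * m * (τ ^ 2 - τ ^ 4 / 2) * a 1 (n - 1) q k τ)
      (x₂ := 0)] at h'
  · linear_combination h'
  · simp [rhoJet_zero, hu.x_axis hρ₀ τ hτ]
  · intro _
    rw [hu.rhoJet_x_one hρ₀ hτ]
    ring
  · intro hn
    rw [hz' 1 (n - 2) (by omega), mul_zero]
  · intro i hi hin
    rw [hz' 1 (n - i) (by omega), mul_zero]
  · simp [rhoJet_zero, hu.c0_axis hρ₀ τ hτ, hu.c1_axis hρ₀ τ hτ, hu.c_axis hρ₀ τ hτ]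
  · intro hn
    rw [hu.rhoJet_c0_one hρ₀ hτ, hu.rhoJet_c1_one hρ₀ hτ, hu.rhoJet_c_one hρ₀ hτ,
      Nat.sub_add_cancel hn]
    ring
  · intro hn
    rw [hd 1 (n - 2) (by omega), hz' 0 (n - 2) (by omega), hz' 2 (n - 2) (by omega),
      hu.rhoJet_c1_two hρ₀ hτ, show n - 2 + 1 = n - 1 by omega]
    ring
  · intro i hi hin
    rw [hd 1 (n - i) (by omega), hz' 0 (n - i) (by omega), hz' 2 (n - i) (by omega),
      hz' 1 (n - i + 1) (by omega)]
    ring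

end Transport

/-! ### The equations for `φ₁` and `φ₀ - φ₂` -/

section Reduced

/-- Functions `(-1, 1) → ℂ` that agree there with a complex polynomial. -/
def IsPolynomialOn (y : ℝ → ℂ) : Prop :=
  ∃ P : Polynomial ℂ, ∀ τ ∈ Ioo (-1 : ℝ) 1, y τ = P.eval (τ : ℂ)

namespace IsPolynomialOn

variable {y z : ℝ → ℂ}

theorem const (c : ℂ) : IsPolynomialOn fun _ => c := ⟨Polynomial.C c, by simp⟩

theorem id : IsPolynomialOn fun τ => (τ : ℂ) := ⟨Polynomial.X, by simp⟩

theorem add (hy : IsPolynomialOn y) (hz : IsPolynomialOn z) :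
    IsPolynomialOn fun τ => y τ + z τ := by
  obtain ⟨P, hP⟩ := hy
  obtain ⟨Q, hQ⟩ := hz
  exact ⟨P + Q, fun τ hτ => by simp [hP τ hτ, hQ τ hτ]⟩

theorem sub (hy : IsPolynomialOn y) (hz : IsPolynomialOn z) :
    IsPolynomialOn fun τ => y τ - z τ := by
  obtain ⟨P, hP⟩ := hy
  obtain ⟨Q, hQ⟩ := hz
  exact ⟨P - Q, fun τ hτ => by simp [hP τ hτ, hQ τ hτ]⟩

theorem mul (hy : IsPolynomialOn y) (hz : IsPolynomialOn z) :
    IsPolynomialOn fun τ => y τ * z τ := by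
  obtain ⟨P, hP⟩ := hy
  obtain ⟨Q, hQ⟩ := hz
  exact ⟨P * Q, fun τ hτ => by simp [hP τ hτ, hQ τ hτ]⟩

theorem pow (hy : IsPolynomialOn y) (j : ℕ) : IsPolynomialOn fun τ => y τ ^ j := by
  obtain ⟨P, hP⟩ := hy
  exact ⟨P ^ j, fun τ hτ => by simp [hP τ hτ]⟩

theorem congr (hy : IsPolynomialOn y) (h : ∀ τ ∈ Ioo (-1 : ℝ) 1, z τ = y τ) :
    IsPolynomialOn z := by
  obtain ⟨P, hP⟩ := hy
  exact ⟨P, fun τ hτ => (h τ hτ).trans (hP τ hτ)⟩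

end IsPolynomialOn

theorem exists_derivative_eq (P : Polynomial ℂ) : ∃ Q : Polynomial ℂ, Q.derivative = P := by
  induction P using Polynomial.induction_on' with
  | add P Q hP hQ =>
    obtain ⟨P', rfl⟩ := hP
    obtain ⟨Q', rfl⟩ := hQ
    exact ⟨P' + Q', Polynomial.derivative_add⟩
  | monomial n c =>
    refine ⟨Polynomial.monomial (n + 1) (c / (n + 1)), ?_⟩
    have : (n : ℂ) + 1 ≠ 0 := Nat.cast_add_one_ne_zero n
    rw [Polynomial.derivative_monomial]
    push_cast
    rw [div_mul_cancel₀ _ this]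

/-- A primitive of a polynomial is a polynomial: this is where logarithms would enter. -/
theorem IsPolynomialOn.of_hasDerivAt {y y' : ℝ → ℂ} (hy' : IsPolynomialOn y')
    (hy : ∀ τ ∈ Ioo (-1 : ℝ) 1, HasDerivAt y (y' τ) τ) : IsPolynomialOn y := by
  obtain ⟨P, hP⟩ := hy'
  obtain ⟨Q, rfl⟩ := exists_derivative_eq P
  refine ⟨Q + Polynomial.C (y 0 - Q.eval 0), ?_⟩
  refine eq_of_hasDerivAt_eq hy (fun τ hτ => ?_) (by simp)
  rw [hP τ hτ]
  have h := ((Q + Polynomial.C (y 0 - Q.eval 0)).hasDerivAt (τ : ℂ)).comp_ofReal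
  simpa using h

theorem one_sub_sq_pos {τ : ℝ} (hτ : τ ∈ Ioo (-1 : ℝ) 1) : 0 < 1 - τ ^ 2 := by
  nlinarith [hτ.1, hτ.2]

theorem one_sub_sq_ne_zero {τ : ℝ} (hτ : τ ∈ Ioo (-1 : ℝ) 1) : (1 - (τ : ℂ) ^ 2) ≠ 0 := by
  exact_mod_cast (one_sub_sq_pos hτ).ne'

theorem norm_one_sub_sq {τ : ℝ} (hτ : τ ∈ Ioo (-1 : ℝ) 1) :
    ‖1 - (τ : ℂ) ^ 2‖ = 1 - τ ^ 2 := by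
  rw [← abs_of_pos (one_sub_sq_pos hτ), ← Real.norm_eq_abs, ← Complex.norm_real]
  push_cast
  rfl

/-- Uniqueness for `(1 - τ²) y'' = α y + β τ y'`, whose coefficients are singular only at the
critical points `τ = ± 1`. -/
theorem eq_zero_of_second_order {α β : ℂ} {y z : ℝ → ℂ}
    (hy : ∀ τ ∈ Ioo (-1 : ℝ) 1, HasDerivAt y (z τ) τ)
    (hz : ∀ τ ∈ Ioo (-1 : ℝ) 1,
      HasDerivAt z ((α * y τ + β * τ * z τ) / (1 - (τ : ℂ) ^ 2)) τ)
    (hy0 : y 0 = 0) (hz0 : z 0 = 0) :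
    ∀ τ ∈ Ioo (-1 : ℝ) 1, y τ = 0 ∧ z τ = 0 := by
  intro τ hτ
  have key := eq_zero_of_norm_deriv_le (y := fun t => (y t, z t))
    (y' := fun t => (z t, (α * y t + β * t * z t) / (1 - (t : ℂ) ^ 2)))
    (g := fun t => 1 + (‖α‖ + ‖β‖) / (1 - t ^ 2))
    (continuousOn_const.add (continuousOn_const.div (by fun_prop)
      fun t ht => (one_sub_sq_pos ht).ne'))
    (fun t ht => (hy t ht).prodMk (hz t ht)) (by simp [hy0, hz0]) (fun t ht => ?_) τ hτ
  · simpa using key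
  · have hs := one_sub_sq_pos ht
    have h1 : ‖y t‖ ≤ ‖(y t, z t)‖ := le_max_left _ _
    have h2 : ‖z t‖ ≤ ‖(y t, z t)‖ := le_max_right _ _
    have ht1 : |t| ≤ 1 := abs_le.mpr ⟨ht.1.le, ht.2.le⟩
    have h0 := norm_nonneg (y t, z t)
    refine max_le ?_ ?_
    · have : 0 ≤ (‖α‖ + ‖β‖) / (1 - t ^ 2) * ‖(y t, z t)‖ := by positivity
      change ‖z t‖ ≤ _
      linarith
    · change ‖(α * y t + β * t * z t) / (1 - (t : ℂ) ^ 2)‖ ≤ _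
      rw [norm_div, norm_one_sub_sq ht]
      have hnum : ‖α * y t + β * t * z t‖ ≤ (‖α‖ + ‖β‖) * ‖(y t, z t)‖ := by
        refine (norm_add_le _ _).trans ?_
        rw [norm_mul, norm_mul, norm_mul, Complex.norm_real, Real.norm_eq_abs]
        have e1 := mul_le_mul_of_nonneg_left h1 (norm_nonneg α)
        have e2 : ‖β‖ * |t| * ‖z t‖ ≤ ‖β‖ * 1 * ‖(y t, z t)‖ := by gcongr
        linarith
      calc ‖α * y t + β * t * z t‖ / (1 - t ^ 2)
          ≤ (‖α‖ + ‖β‖) * ‖(y t, z t)‖ / (1 - t ^ 2) := by gcongr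
        _ = (‖α‖ + ‖β‖) / (1 - t ^ 2) * ‖(y t, z t)‖ := by ring
        _ ≤ (1 + (‖α‖ + ‖β‖) / (1 - t ^ 2)) * ‖(y t, z t)‖ := by linarith

theorem hasDerivAt_one_sub_sq_pow (j : ℕ) {τ : ℝ} (hτ : τ ∈ Ioo (-1 : ℝ) 1) :
    HasDerivAt (fun t : ℝ => (1 - (t : ℂ) ^ 2) ^ j)
      (-2 * j * τ * (1 - (τ : ℂ) ^ 2) ^ j / (1 - (τ : ℂ) ^ 2)) τ := by
  have h := ((((hasDerivAt_id' (τ : ℂ)).fun_pow 2).const_sub 1).fun_pow j).comp_ofReal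
  refine h.congr_deriv ?_
  have hs := one_sub_sq_ne_zero hτ
  rcases j with _ | j
  · simp
  · rw [eq_div_iff hs, pow_succ (1 - (τ : ℂ) ^ 2) j, Nat.add_sub_cancel]
    push_cast
    ring

/-- Solutions of `(1 - τ²) y' = - 2 j τ y` are multiples of `(1 - τ²)^j`. -/
theorem eq_mul_one_sub_sq_pow {j : ℕ} {y : ℝ → ℂ}
    (hy : ∀ τ ∈ Ioo (-1 : ℝ) 1,
      HasDerivAt y (-2 * j * τ * y τ / (1 - (τ : ℂ) ^ 2)) τ) :
    ∀ τ ∈ Ioo (-1 : ℝ) 1, y τ = y 0 * (1 - (τ : ℂ) ^ 2) ^ j := by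
  intro τ hτ
  have hq : ∀ t ∈ Ioo (-1 : ℝ) 1,
      HasDerivAt (fun t : ℝ => y t / (1 - (t : ℂ) ^ 2) ^ j) 0 t := fun t ht => by
    have hs := one_sub_sq_ne_zero ht
    refine ((hy t ht).fun_div (hasDerivAt_one_sub_sq_pow j ht) (pow_ne_zero j hs)).congr_deriv ?_
    field_simp
    ring
  have h := eq_of_hasDerivAt_eq hq (fun t _ => hasDerivAt_const t (y 0)) (by simp) τ hτ
  exact (div_eq_iff (pow_ne_zero j (one_sub_sq_ne_zero hτ))).mp h

/-- Eliminating `φ₀ + φ₂` by the constraint leaves an equation for `w = (φ₀ - φ₂) / 2`. Here `b₀`,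
`b₂` stand for the extreme components multiplied by the mode factor, `M` for the square of that
factor and `N + 1` for the order. -/
theorem difference_equation {τ N M b₀ b₁ b₂ d₀ d₁ d₂ S₀ S₁ S₂ S₃ : ℂ}
    (h₀ : (1 + τ) * d₀ = N * b₀ - M * b₁ + S₀) (h₁ : d₁ = (b₀ - b₂) / 2 + S₁)
    (h₂ : (1 - τ) * d₂ = -N * b₂ + M * b₁ + S₂)
    (h₃ : (N + 1) * b₁ - τ * d₁ - (b₀ + b₂) / 2 = S₃) :
    (1 - τ ^ 2) * ((d₀ - d₂) / 2) =
      ((N + 1) * N - M) * b₁ - 2 * N * τ * ((b₀ - b₂) / 2)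
        + (-N * (τ * S₁ + S₃) + ((1 - τ) * S₀ - (1 + τ) * S₂) / 2) := by
  linear_combination (1 - τ) / 2 * h₀ - (1 + τ) / 2 * h₂ - N * τ * h₁ - N * h₃

theorem modeFactor_sq (q : ℕ) : modeFactor q ^ 2 = (q : ℂ) * (q + 1) := by
  have h : (0 : ℝ) ≤ (q : ℝ) * ((q : ℝ) + 1) := by positivity
  rw [modeFactor, ← Complex.ofReal_pow, Real.sq_sqrt h]
  push_cast
  rfl

theorem modeFactor_ne_zero {q : ℕ} (hq : 1 ≤ q) : modeFactor q ≠ 0 := by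
  have hq' : (q : ℂ) ≠ 0 := Nat.cast_ne_zero.mpr (by omega)
  have h : modeFactor q ^ 2 ≠ 0 := by
    rw [modeFactor_sq]
    exact mul_ne_zero hq' (Nat.cast_add_one_ne_zero q)
  exact fun h0 => h (by simp [h0])

end Reduced

/-! ### Solving the transport equations order by order -/

section Orders

variable {m ρ₀ : ℝ} {u : FGaugeFields} {a : Fin 3 → ℕ → ℕ → ℕ → ℝ → ℂ} {n p k : ℕ}

/-- Half the difference of the extreme components of order `n`, scaled by the mode factor. -/
noncomputable def extremeDifference (a : Fin 3 → ℕ → ℕ → ℕ → ℝ → ℂ) (n p k : ℕ) (τ : ℝ) : ℂ :=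
  (modeFactor p * a 0 n p k τ - modeFactor p * a 2 n p k τ) / 2

theorem MaxwellTransport.hasDerivAt_extremeDifference (h : MaxwellTransport u a n p k) {τ : ℝ}
    (hτ : τ ∈ Ioo (-1 : ℝ) 1) :
    HasDerivAt (extremeDifference a n p k)
      ((modeFactor p * deriv (a 0 n p k) τ - modeFactor p * deriv (a 2 n p k) τ) / 2) τ :=
  ((((h.differentiable 0 τ hτ).hasDerivAt.const_mul (modeFactor p)).fun_sub
    ((h.differentiable 2 τ hτ).hasDerivAt.const_mul (modeFactor p))).div_const 2)

/-- At the lowest order present there are no sources. -/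
theorem lowest_order (hu : IsSchwarzschildFGaugeOn m ρ₀ u) (hρ₀ : 0 < ρ₀)
    (h : MaxwellTransport u a n p k)
    (hz : ∀ j : Fin 3, ∀ l < n, ∀ τ ∈ Ioo (-1 : ℝ) 1, a j l p k τ = 0) {τ : ℝ}
    (hτ : τ ∈ Ioo (-1 : ℝ) 1) :
    (1 + τ) * (modeFactor p * deriv (a 0 n p k) τ) =
        (n - 1) * (modeFactor p * a 0 n p k τ) - p * (p + 1) * a 1 n p k τ ∧
      (1 - τ) * (modeFactor p * deriv (a 2 n p k) τ) =
        -(n - 1) * (modeFactor p * a 2 n p k τ) + p * (p + 1) * a 1 n p k τ ∧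
      HasDerivAt (a 1 n p k) (extremeDifference a n p k τ) τ ∧
      HasDerivAt (extremeDifference a n p k)
        (((n * (n - 1) - p * (p + 1)) * a 1 n p k τ
          + -2 * (n - 1) * τ * extremeDifference a n p k τ) / (1 - (τ : ℂ) ^ 2)) τ ∧
      modeFactor p * a 0 n p k τ = n * a 1 n p k τ + (1 - τ) * extremeDifference a n p k τ ∧
      modeFactor p * a 2 n p k τ = n * a 1 n p k τ - (1 + τ) * extremeDifference a n p k τ := by
  have hz2 : ∀ j : Fin 3, ∀ l, l + 1 < n → ∀ τ ∈ Ioo (-1 : ℝ) 1, a j l p k τ = 0 :=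
    fun j l hl => hz j l (by omega)
  -- the truncated `n - 1` at `n = 0` is harmless: its terms carry a factor `n` or `n.choose 2`
  have hlow : ∀ j : Fin 3, (n : ℂ) * a j (n - 1) p k τ = 0 := fun j => by
    rcases n with _ | n
    · simp
    · simp [hz j n (by omega) τ hτ]
  have hchoose : ∀ j : Fin 3, (n.choose 2 : ℂ) * a j (n - 1) p k τ = 0 := fun j => by
    rcases n with _ | n
    · simp
    · simp [hz j n (by omega) τ hτ]
  have hlow' : ∀ j : Fin 3, (n : ℂ) * deriv (a j (n - 1) p k) τ = 0 := fun j => by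
    rcases n with _ | n
    · simp
    · simp [deriv_eq_zero_of_vanish (hz j n (by omega)) hτ]
  have h₀ := h.propagation_zero_reduced hu hρ₀ hz2 hτ
  have h₁ := h.propagation_one_reduced hu hρ₀ hz2 hτ
  have h₂ := h.propagation_two_reduced hu hρ₀ hz2 hτ
  have h₃ := h.constraint_reduced hu hρ₀ hz2 hτ
  have hM := modeFactor_sq p
  have e₀ : (1 + τ) * (modeFactor p * deriv (a 0 n p k) τ) =
      (n - 1) * (modeFactor p * a 0 n p k τ) - p * (p + 1) * a 1 n p k τ + 0 := by
    rw [← hM]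
    linear_combination modeFactor p * h₀
      + modeFactor p * (m * (4 * τ ^ 3 / 3 - τ ^ 5 / 3)) * hlow' 0
      - modeFactor p * (modeFactor p * (m * (τ ^ 2 - τ ^ 4 / 6))) * hlow 1
      + modeFactor p * (m * (-2 * τ + τ ^ 2 + 2 * τ ^ 3 / 3 - 5 * τ ^ 4 / 6)) * hlow 0
      - modeFactor p * (m * (4 * τ ^ 2 - 2 * τ ^ 4 / 3)) * hchoose 0
  have e₁ : deriv (a 1 n p k) τ =
      (modeFactor p * a 0 n p k τ - modeFactor p * a 2 n p k τ) / 2 + 0 := by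
    linear_combination h₁
      + 1 / 2 * modeFactor p * (m * (τ ^ 2 - τ ^ 4 / 6)) * (hlow 0 - hlow 2)
      + 4 * m * (τ - τ ^ 3 / 3) * hlow 1
  have e₂ : (1 - τ) * (modeFactor p * deriv (a 2 n p k) τ) =
      -(n - 1) * (modeFactor p * a 2 n p k τ) + p * (p + 1) * a 1 n p k τ + 0 := by
    rw [← hM]
    linear_combination modeFactor p * h₂
      - modeFactor p * (m * (4 * τ ^ 3 / 3 - τ ^ 5 / 3)) * hlow' 2
      + modeFactor p * (modeFactor p * (m * (τ ^ 2 - τ ^ 4 / 6))) * hlow 1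
      + modeFactor p * (m * (-2 * τ - τ ^ 2 + 2 * τ ^ 3 / 3 + 5 * τ ^ 4 / 6)) * hlow 2
      + modeFactor p * (m * (4 * τ ^ 2 - 2 * τ ^ 4 / 3)) * hchoose 2
  have e₃ : ((n - 1 : ℂ) + 1) * a 1 n p k τ - τ * deriv (a 1 n p k) τ
      - (modeFactor p * a 0 n p k τ + modeFactor p * a 2 n p k τ) / 2 = 0 := by
    linear_combination h₃
      - (m * (4 * τ ^ 3 / 3 - τ ^ 5 / 3)) * hlow' 1
      + 1 / 2 * modeFactor p * (m * (τ ^ 2 - τ ^ 4 / 6)) * (hlow 0 + hlow 2)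
      - 2 * m * (τ ^ 2 - τ ^ 4 / 2) * hlow 1
      + (m * (4 * τ ^ 2 - 2 * τ ^ 4 / 3)) * hchoose 1
  have key := difference_equation e₀ e₁ e₂ e₃
  have hw : (modeFactor p * a 0 n p k τ - modeFactor p * a 2 n p k τ) / 2 =
    extremeDifference a n p k τ := rfl
  refine ⟨by linear_combination e₀, by linear_combination e₂, ?_, ?_, ?_, ?_⟩
  · have := (h.differentiable 1 τ hτ).hasDerivAt
    rwa [e₁, add_zero, hw] at this
  · refine (h.hasDerivAt_extremeDifference hτ).congr_deriv ?_
    rw [eq_div_iff (one_sub_sq_ne_zero hτ), ← hw]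
    linear_combination key
  · linear_combination (norm := (rw [← hw]; ring)) -e₃ - τ * e₁
  · linear_combination (norm := (rw [← hw]; ring)) -e₃ - τ * e₁

/-- Below the first order present in the initial data, the solution vanishes. -/
theorem vanish_below (hu : IsSchwarzschildFGaugeOn m ρ₀ u) (hρ₀ : 0 < ρ₀) (hp : 1 ≤ p)
    (hsol : ∀ n ≤ p + 1, MaxwellTransport u a n p k)
    (hdata : ∀ j : Fin 3, ∀ n < p, a j n p k 0 = 0) :
    ∀ n < p, ∀ j : Fin 3, ∀ τ ∈ Ioo (-1 : ℝ) 1, a j n p k τ = 0 := by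
  intro n
  induction n using Nat.strong_induction_on with
  | _ n ih =>
    intro hn j τ hτ
    have hz : ∀ j : Fin 3, ∀ l < n, ∀ τ ∈ Ioo (-1 : ℝ) 1, a j l p k τ = 0 :=
      fun j l hl => ih l hl (by omega) j
    have hlow := fun τ hτ => lowest_order hu hρ₀ (hsol n (by omega)) hz (τ := τ) hτ
    obtain ⟨h1, hw⟩ := eq_zero_of_second_order (fun t ht => (hlow t ht).2.2.1)
      (fun t ht => (hlow t ht).2.2.2.1) (hdata 1 n hn)
      (by simp [extremeDifference, hdata 0 n hn, hdata 2 n hn]) τ hτ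
    obtain ⟨-, -, -, -, h0, h2⟩ := hlow τ hτ
    have hM := modeFactor_ne_zero hp
    rw [h1, hw] at h0 h2
    fin_cases j
    · exact (mul_eq_zero.mp (h0.trans (by ring))).resolve_left hM
    · exact h1
    · exact (mul_eq_zero.mp (h2.trans (by ring))).resolve_left hM

/-- At order `p`, the regularity condition selects the even solution `A (1 - τ²)^p` for the middle
component; the other solution has logarithms. -/
theorem order_eq (hu : IsSchwarzschildFGaugeOn m ρ₀ u) (hρ₀ : 0 < ρ₀) (hp : 1 ≤ p)
    (hsol : ∀ n ≤ p + 1, MaxwellTransport u a n p k)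
    (hdata : ∀ j : Fin 3, ∀ n < p, a j n p k 0 = 0) (hreg : a 0 p p k 0 = a 2 p p k 0) :
    ∀ τ ∈ Ioo (-1 : ℝ) 1,
      a 1 p p k τ = a 1 p p k 0 * (1 - (τ : ℂ) ^ 2) ^ p ∧
      extremeDifference a p p k τ =
        -2 * p * τ * (a 1 p p k 0 * (1 - (τ : ℂ) ^ 2) ^ p / (1 - (τ : ℂ) ^ 2)) := by
  intro τ hτ
  have hlow := fun τ hτ => lowest_order hu hρ₀ (hsol p (by omega))
    (fun j l hl => vanish_below hu hρ₀ hp hsol hdata l hl j) (τ := τ) hτ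
  obtain ⟨h1, h2⟩ := eq_zero_of_second_order (α := (p * (p - 1) - p * (p + 1)))
    (β := -2 * (p - 1))
    (y := fun t => a 1 p p k t - a 1 p p k 0 * (1 - (t : ℂ) ^ 2) ^ p)
    (z := fun t => extremeDifference a p p k t
      - -2 * p * t * (a 1 p p k 0 * (1 - (t : ℂ) ^ 2) ^ p / (1 - (t : ℂ) ^ 2)))
    (fun t ht => ((hlow t ht).2.2.1.fun_sub
      ((hasDerivAt_one_sub_sq_pow p ht).const_mul (a 1 p p k 0))).congr_deriv (by ring))
    (fun t ht => by
      have hs := one_sub_sq_ne_zero ht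
      have hlin : HasDerivAt (fun t : ℝ => -2 * (p : ℂ) * (t : ℂ)) (-2 * p) t := by
        simpa using ((hasDerivAt_id' (t : ℂ)).const_mul (-2 * (p : ℂ))).comp_ofReal
      have hsq : HasDerivAt (fun t : ℝ => (1 : ℂ) - (t : ℂ) ^ 2) (-2 * (t : ℂ)) t := by
        simpa using (((hasDerivAt_id' (t : ℂ)).fun_pow 2).const_sub 1).comp_ofReal
      refine ((hlow t ht).2.2.2.1.fun_sub (hlin.fun_mul
        (((hasDerivAt_one_sub_sq_pow p ht).const_mul (a 1 p p k 0)).fun_div hsq hs))).congr_deriv ?_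
      field_simp
      ring)
    (by simp) (by simp [extremeDifference, hreg]) τ hτ
  exact ⟨sub_eq_zero.mp h1, sub_eq_zero.mp h2⟩

end Orders

/-! ### Order `p + 1` -/

section NextOrder

/-- The source of the middle propagation equation at order `p + 1`, for the solution of order `p`,
in units of `m (p + 1) B` with `B = A (1 - τ²)^(p - 1)`; the units are the same below. -/
noncomputable def middleSource (p τ : ℂ) : ℂ :=
  -2 * p * τ * (τ ^ 2 - τ ^ 4 / 6) + 4 * (τ - τ ^ 3 / 3) * (1 - τ ^ 2)

/-- The source of the constraint at order `p + 1`. -/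
noncomputable def constraintSource (p τ : ℂ) : ℂ :=
  2 * p * τ * (4 * τ ^ 3 / 3 - τ ^ 5 / 3) + p * (τ ^ 2 - τ ^ 4 / 6) * (1 + τ ^ 2)
    - 2 * (τ ^ 2 - τ ^ 4 / 2) * (1 - τ ^ 2)
    + p / 2 * (4 * τ ^ 2 - 2 * τ ^ 4 / 3) * (1 - τ ^ 2)

/-- The source of the first propagation equation at order `p + 1`. -/
noncomputable def upperSource (p τ : ℂ) : ℂ :=
  (4 * τ ^ 3 / 3 - τ ^ 5 / 3) * (-2 * p * (1 - τ) ^ 2 * (1 + p * τ) / (1 - τ ^ 2))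
    - p * (p + 1) * (τ ^ 2 - τ ^ 4 / 6) * (1 - τ ^ 2)
    + (-2 * τ + τ ^ 2 + 2 * τ ^ 3 / 3 - 5 * τ ^ 4 / 6) * (p * (1 - τ) ^ 2)
    - p / 2 * (4 * τ ^ 2 - 2 * τ ^ 4 / 3) * (p * (1 - τ) ^ 2)

/-- The source of the last propagation equation at order `p + 1`. -/
noncomputable def lowerSource (p τ : ℂ) : ℂ :=
  -(4 * τ ^ 3 / 3 - τ ^ 5 / 3) * (2 * p * (1 + τ) ^ 2 * (1 - p * τ) / (1 - τ ^ 2))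
    + p * (p + 1) * (τ ^ 2 - τ ^ 4 / 6) * (1 - τ ^ 2)
    + (-2 * τ - τ ^ 2 + 2 * τ ^ 3 / 3 + 5 * τ ^ 4 / 6) * (p * (1 + τ) ^ 2)
    + p / 2 * (4 * τ ^ 2 - 2 * τ ^ 4 / 3) * (p * (1 + τ) ^ 2)

/-- The source of the equation for the difference of the extreme components. -/
noncomputable def differenceSource (p τ : ℂ) : ℂ :=
  -p * (τ * middleSource p τ + constraintSource p τ)
    + ((1 - τ) * upperSource p τ - (1 + τ) * lowerSource p τ) / 2

/-- A particular solution of the equation for the difference of the extreme components at order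
`p + 1`, for `m (p + 1) A = 1`. It is in fact a polynomial: `(1 - τ²)^p` is divided by `1 - τ²`
twice only with the factor `p - 1`. -/
noncomputable def particularDifference (p : ℕ) (τ : ℝ) : ℂ :=
  p / 3 * τ ^ 3 * (((p + 3) * τ ^ 2 - 2) * ((1 - (τ : ℂ) ^ 2) ^ p / (1 - (τ : ℂ) ^ 2))
    - 6 * (p - 1) * ((1 - (τ : ℂ) ^ 2) ^ p / (1 - (τ : ℂ) ^ 2) ^ 2))

theorem hasDerivAt_particularDifference (p : ℕ) {τ : ℝ} (hτ : τ ∈ Ioo (-1 : ℝ) 1) :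
    HasDerivAt (particularDifference p)
      ((-2 * p * τ * particularDifference p τ
        + (1 - (τ : ℂ) ^ 2) ^ p / (1 - (τ : ℂ) ^ 2) * differenceSource p τ)
          / (1 - (τ : ℂ) ^ 2)) τ := by
  have hs := one_sub_sq_ne_zero hτ
  have hid : HasDerivAt (fun t : ℝ => (t : ℂ)) 1 τ := (hasDerivAt_id' (τ : ℂ)).comp_ofReal
  have hsq : HasDerivAt (fun t : ℝ => (1 : ℂ) - (t : ℂ) ^ 2) (-2 * (τ : ℂ)) τ := by
    simpa using (hid.fun_pow 2).const_sub 1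
  have hE := hasDerivAt_one_sub_sq_pow p hτ
  refine (((hid.fun_pow 3).const_mul ((p : ℂ) / 3)).fun_mul
    (((((hid.fun_pow 2).const_mul ((p : ℂ) + 3)).sub_const 2).fun_mul (hE.fun_div hsq hs)).fun_sub
      ((hE.fun_div (hsq.fun_pow 2) (pow_ne_zero 2 hs)).const_mul (6 * ((p : ℂ) - 1))))).congr_deriv
    ?_
  simp only [particularDifference, differenceSource, middleSource, constraintSource, upperSource,
    lowerSource]
  generalize (1 - (τ : ℂ) ^ 2) ^ p = E
  norm_num
  field_simp
  ring

theorem isPolynomialOn_one_sub_sq_pow (j : ℕ) :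
    IsPolynomialOn fun τ => (1 - (τ : ℂ) ^ 2) ^ j :=
  ((IsPolynomialOn.const 1).sub (IsPolynomialOn.id.pow 2)).pow j

theorem isPolynomialOn_one_sub_sq_pow_div {p : ℕ} (hp : 1 ≤ p) :
    IsPolynomialOn fun τ => (1 - (τ : ℂ) ^ 2) ^ p / (1 - (τ : ℂ) ^ 2) := by
  refine (isPolynomialOn_one_sub_sq_pow (p - 1)).congr fun τ hτ => ?_
  rw [div_eq_iff (one_sub_sq_ne_zero hτ), ← pow_succ, Nat.sub_add_cancel hp]

theorem isPolynomialOn_particularDifference {p : ℕ} (hp : 1 ≤ p) :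
    IsPolynomialOn (particularDifference p) := by
  have h : IsPolynomialOn fun τ =>
      6 * ((p : ℂ) - 1) * ((1 - (τ : ℂ) ^ 2) ^ p / (1 - (τ : ℂ) ^ 2) ^ 2) := by
    refine ((IsPolynomialOn.const (6 * ((p : ℂ) - 1))).mul
      (isPolynomialOn_one_sub_sq_pow (p - 2))).congr fun τ hτ => ?_
    -- for `p = 1` the exponent `p - 2` truncates, but the coefficient `p - 1` vanishes
    rcases eq_or_lt_of_le hp with rfl | hp
    · simp
    · rw [(div_eq_iff (pow_ne_zero 2 (one_sub_sq_ne_zero hτ))).mpr]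
      rw [← pow_add, Nat.sub_add_cancel hp]
  exact ((IsPolynomialOn.const _).mul (IsPolynomialOn.id.pow 3)).mul
    (((((IsPolynomialOn.const _).mul (IsPolynomialOn.id.pow 2)).sub (IsPolynomialOn.const 2)).mul
      (isPolynomialOn_one_sub_sq_pow_div hp)).sub h)

theorem isPolynomialOn_middleSource (p : ℂ) : IsPolynomialOn fun τ => middleSource p τ :=
  ⟨Polynomial.C (-2 * p) * Polynomial.X * (Polynomial.X ^ 2 - Polynomial.C (1 / 6)
      * Polynomial.X ^ 4) + 4 * (Polynomial.X - Polynomial.C (1 / 3) * Polynomial.X ^ 3)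
      * (1 - Polynomial.X ^ 2), fun τ _ => by simp [middleSource]; ring⟩

theorem isPolynomialOn_constraintSource (p : ℂ) : IsPolynomialOn fun τ => constraintSource p τ :=
  ⟨Polynomial.C (2 * p) * Polynomial.X * (Polynomial.C (4 / 3) * Polynomial.X ^ 3
      - Polynomial.C (1 / 3) * Polynomial.X ^ 5)
    + Polynomial.C p * (Polynomial.X ^ 2 - Polynomial.C (1 / 6) * Polynomial.X ^ 4)
      * (1 + Polynomial.X ^ 2)
    - 2 * (Polynomial.X ^ 2 - Polynomial.C (1 / 2) * Polynomial.X ^ 4) * (1 - Polynomial.X ^ 2)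
    + Polynomial.C (p / 2) * (4 * Polynomial.X ^ 2 - Polynomial.C (2 / 3) * Polynomial.X ^ 4)
      * (1 - Polynomial.X ^ 2), fun τ _ => by simp [constraintSource]; ring⟩

variable {m ρ₀ : ℝ} {u : FGaugeFields} {a : Fin 3 → ℕ → ℕ → ℕ → ℝ → ℂ} {p k : ℕ}

/-- The equations of order `p + 1` with their sources. The homogeneous part no longer couples the
difference of the extreme components to the middle one, since `n (n - 1) = p (p + 1)` for
`n = p + 1`. -/
theorem next_order (hu : IsSchwarzschildFGaugeOn m ρ₀ u) (hρ₀ : 0 < ρ₀) (hp : 1 ≤ p)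
    (hsol : ∀ n ≤ p + 1, MaxwellTransport u a n p k)
    (hdata : ∀ j : Fin 3, ∀ n < p, a j n p k 0 = 0) (hreg : a 0 p p k 0 = a 2 p p k 0) {τ : ℝ}
    (hτ : τ ∈ Ioo (-1 : ℝ) 1) {B : ℂ}
    (hB : B = m * (p + 1) * a 1 p p k 0 * ((1 - (τ : ℂ) ^ 2) ^ p / (1 - (τ : ℂ) ^ 2))) :
    HasDerivAt (a 1 (p + 1) p k)
        (extremeDifference a (p + 1) p k τ + B * middleSource p τ) τ ∧
      HasDerivAt (extremeDifference a (p + 1) p k)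
        ((-2 * p * τ * extremeDifference a (p + 1) p k τ + B * differenceSource p τ)
          / (1 - (τ : ℂ) ^ 2)) τ ∧
      modeFactor p * (a 0 (p + 1) p k τ + a 2 (p + 1) p k τ) =
        2 * ((p + 1) * a 1 (p + 1) p k τ
          - τ * (extremeDifference a (p + 1) p k τ + B * middleSource p τ)
          - B * constraintSource p τ) := by
  have hlt := vanish_below hu hρ₀ hp hsol hdata
  have hz : ∀ j : Fin 3, ∀ l, l + 1 < p + 1 → ∀ τ ∈ Ioo (-1 : ℝ) 1, a j l p k τ = 0 :=
    fun j l hl => hlt l (by omega) j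
  have h := hsol (p + 1) le_rfl
  have h₀ := h.propagation_zero_reduced hu hρ₀ hz hτ
  have h₁ := h.propagation_one_reduced hu hρ₀ hz hτ
  have h₂ := h.propagation_two_reduced hu hρ₀ hz hτ
  have h₃ := h.constraint_reduced hu hρ₀ hz hτ
  have hs := one_sub_sq_ne_zero hτ
  have hplus : (1 + τ : ℂ) ≠ 0 := fun h0 => hs (by linear_combination (1 - (τ : ℂ)) * h0)
  have hminus : (1 - τ : ℂ) ≠ 0 := fun h0 => hs (by linear_combination (1 + (τ : ℂ)) * h0)
  have hchoose : ((p + 1).choose 2 : ℂ) = (p + 1) * (p / 2) := by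
    rw [Nat.cast_choose_two]
    push_cast
    ring
  obtain ⟨q₁, qw⟩ := order_eq hu hρ₀ hp hsol hdata hreg τ hτ
  obtain ⟨d₀, d₂, d₁, -, b₀, b₂⟩ := lowest_order hu hρ₀ (hsol p (by omega))
    (fun j l hl => hlt l hl j) hτ
  -- `b` is the common factor `A (1 - τ²)^(p - 1)` of the solution of order `p`
  obtain ⟨b, hb⟩ : ∃ b, b = a 1 p p k 0 * ((1 - (τ : ℂ) ^ 2) ^ p / (1 - (τ : ℂ) ^ 2)) := ⟨_, rfl⟩
  have hBb : B = m * (p + 1) * b := by rw [hB, hb]; ring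
  have q₁' : a 1 p p k τ = b * (1 - (τ : ℂ) ^ 2) := by
    rw [q₁, hb]
    field_simp
  have qw' : extremeDifference a p p k τ = -2 * p * τ * b := by
    rw [qw, hb]
    ring
  rw [q₁', qw'] at b₀ b₂
  replace b₀ : modeFactor p * a 0 p p k τ = b * (p * (1 - τ) ^ 2) := by linear_combination b₀
  replace b₂ : modeFactor p * a 2 p p k τ = b * (p * (1 + τ) ^ 2) := by linear_combination b₂
  rw [b₀, q₁'] at d₀
  rw [b₂, q₁'] at d₂
  have d₀' : modeFactor p * deriv (a 0 p p k) τ =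
      b * (-2 * p * (1 - τ) ^ 2 * (1 + p * τ) / (1 - (τ : ℂ) ^ 2)) := by
    rw [← mul_div_assoc, eq_div_iff hs]
    linear_combination (1 - (τ : ℂ)) * d₀
  have d₂' : modeFactor p * deriv (a 2 p p k) τ =
      b * (2 * p * (1 + τ) ^ 2 * (1 - p * τ) / (1 - (τ : ℂ) ^ 2)) := by
    rw [← mul_div_assoc, eq_div_iff hs]
    linear_combination (1 + (τ : ℂ)) * d₂
  have d₁' : deriv (a 1 p p k) τ = -2 * p * τ * b := d₁.deriv.trans qw'
  have hM := modeFactor_sq p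
  simp only [Nat.add_sub_cancel, Nat.cast_add, Nat.cast_one, hchoose] at h₀ h₁ h₂ h₃
  have e₀ : (1 + τ) * (modeFactor p * deriv (a 0 (p + 1) p k) τ) =
      p * (modeFactor p * a 0 (p + 1) p k τ) - p * (p + 1) * a 1 (p + 1) p k τ
        + B * upperSource p τ := by
    rw [← hM, hBb, upperSource]
    linear_combination modeFactor p * h₀
      + (p + 1) * (m * (4 * τ ^ 3 / 3 - τ ^ 5 / 3)) * d₀'
      + (p + 1) * (m * (-2 * τ + τ ^ 2 + 2 * τ ^ 3 / 3 - 5 * τ ^ 4 / 6)) * b₀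
      - (p + 1) * (p / 2) * (m * (4 * τ ^ 2 - 2 * τ ^ 4 / 3)) * b₀
      - (p + 1) * (m * (τ ^ 2 - τ ^ 4 / 6)) * (modeFactor p ^ 2 * q₁'
        + b * (1 - (τ : ℂ) ^ 2) * hM)
  have e₁ : deriv (a 1 (p + 1) p k) τ =
      (modeFactor p * a 0 (p + 1) p k τ - modeFactor p * a 2 (p + 1) p k τ) / 2
        + B * middleSource p τ := by
    rw [hBb, middleSource]
    linear_combination h₁
      + (p + 1) * (1 / 2 * (m * (τ ^ 2 - τ ^ 4 / 6))) * (b₀ - b₂)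
      + (p + 1) * (4 * m * (τ - τ ^ 3 / 3)) * q₁'
  have e₂ : (1 - τ) * (modeFactor p * deriv (a 2 (p + 1) p k) τ) =
      -p * (modeFactor p * a 2 (p + 1) p k τ) + p * (p + 1) * a 1 (p + 1) p k τ
        + B * lowerSource p τ := by
    rw [← hM, hBb, lowerSource]
    linear_combination modeFactor p * h₂
      - (p + 1) * (m * (4 * τ ^ 3 / 3 - τ ^ 5 / 3)) * d₂'
      + (p + 1) * (m * (-2 * τ - τ ^ 2 + 2 * τ ^ 3 / 3 + 5 * τ ^ 4 / 6)) * b₂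
      + (p + 1) * (p / 2) * (m * (4 * τ ^ 2 - 2 * τ ^ 4 / 3)) * b₂
      + (p + 1) * (m * (τ ^ 2 - τ ^ 4 / 6)) * (modeFactor p ^ 2 * q₁'
        + b * (1 - (τ : ℂ) ^ 2) * hM)
  have e₃ : ((p : ℂ) + 1) * a 1 (p + 1) p k τ - τ * deriv (a 1 (p + 1) p k) τ
      - (modeFactor p * a 0 (p + 1) p k τ + modeFactor p * a 2 (p + 1) p k τ) / 2 =
        B * constraintSource p τ := by
    rw [hBb, constraintSource]
    linear_combination h₃
      - (p + 1) * (m * (4 * τ ^ 3 / 3 - τ ^ 5 / 3)) * d₁'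
      + (p + 1) * (1 / 2 * (m * (τ ^ 2 - τ ^ 4 / 6))) * (b₀ + b₂)
      - (p + 1) * (2 * m * (τ ^ 2 - τ ^ 4 / 2)) * q₁'
      + (p + 1) * (p / 2) * (m * (4 * τ ^ 2 - 2 * τ ^ 4 / 3)) * q₁'
  have key := difference_equation e₀ e₁ e₂ e₃
  have hw : (modeFactor p * a 0 (p + 1) p k τ - modeFactor p * a 2 (p + 1) p k τ) / 2 =
    extremeDifference a (p + 1) p k τ := rfl
  rw [hw] at e₁
  refine ⟨?_, ?_, ?_⟩
  · have := (h.differentiable 1 τ hτ).hasDerivAt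
    rwa [e₁] at this
  · refine (h.hasDerivAt_extremeDifference hτ).congr_deriv ?_
    rw [eq_div_iff hs, ← hw, differenceSource]
    linear_combination key
  · linear_combination -2 * e₃ - 2 * τ * e₁

/-- At order `p + 1` the sources produce no logarithms: the difference of the extreme components is
the particular solution plus a multiple of `(1 - τ²)^p`. -/
theorem isPolynomialOn_extremeDifference (hu : IsSchwarzschildFGaugeOn m ρ₀ u) (hρ₀ : 0 < ρ₀)
    (hp : 1 ≤ p) (hsol : ∀ n ≤ p + 1, MaxwellTransport u a n p k)
    (hdata : ∀ j : Fin 3, ∀ n < p, a j n p k 0 = 0) (hreg : a 0 p p k 0 = a 2 p p k 0) :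
    IsPolynomialOn (extremeDifference a (p + 1) p k) := by
  have hdiff := eq_mul_one_sub_sq_pow (j := p)
    (y := fun t => extremeDifference a (p + 1) p k t
      - m * (p + 1) * a 1 p p k 0 * particularDifference p t) fun τ hτ =>
    ((next_order hu hρ₀ hp hsol hdata hreg hτ rfl).2.1.fun_sub
      ((hasDerivAt_particularDifference p hτ).const_mul
        (m * (p + 1) * a 1 p p k 0))).congr_deriv (by ring)
  refine (((IsPolynomialOn.const (m * (p + 1) * a 1 p p k 0)).mul
    (isPolynomialOn_particularDifference hp)).add
    ((IsPolynomialOn.const (extremeDifference a (p + 1) p k 0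
      - m * (p + 1) * a 1 p p k 0 * particularDifference p 0)).mul
        (isPolynomialOn_one_sub_sq_pow p))).congr fun τ hτ => ?_
  exact sub_eq_iff_eq_add'.mp (hdiff τ hτ)

end NextOrder

theorem proposition4 (m ρ₀ : ℝ) (hρ₀ : 0 < ρ₀) (u : FGaugeFields)
    (hu : IsSchwarzschildFGaugeOn m ρ₀ u)
    (a : Fin 3 → ℕ → ℕ → ℕ → ℝ → ℂ) (p k : ℕ) (hp : 1 ≤ p) (hk : k ≤ 2 * p)
    (hsol : ∀ n ≤ p + 1, MaxwellTransport u a n p k)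
    (hdata : ∀ j : Fin 3, ∀ n < p, a j n p k 0 = 0)
    (hreg : a 0 p p k 0 = a 2 p p k 0) :
    ∀ j : Fin 3, ∃ f : Polynomial ℂ, ∀ τ ∈ Set.Ioo (-1 : ℝ) 1,
      a j (p + 1) p k τ = f.eval (τ : ℂ) := by
  have hw := isPolynomialOn_extremeDifference hu hρ₀ hp hsol hdata hreg
  have hB := (IsPolynomialOn.const (m * (p + 1) * a 1 p p k 0)).mul
    (isPolynomialOn_one_sub_sq_pow_div hp)
  have hd := hw.add (hB.mul (isPolynomialOn_middleSource p))
  have next := fun τ hτ => next_order hu hρ₀ hp hsol hdata hreg (τ := τ) hτ rfl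
  have h1 : IsPolynomialOn (a 1 (p + 1) p k) := hd.of_hasDerivAt fun τ hτ => (next τ hτ).1
  have hsum := (((IsPolynomialOn.const ((p : ℂ) + 1)).mul h1).sub
    (IsPolynomialOn.id.mul hd)).sub (hB.mul (isPolynomialOn_constraintSource p))
  have hM := modeFactor_ne_zero hp
  have hinv := IsPolynomialOn.const (1 / modeFactor p)
  have expand : ∀ τ, extremeDifference a (p + 1) p k τ =
    (modeFactor p * a 0 (p + 1) p k τ - modeFactor p * a 2 (p + 1) p k τ) / 2 := fun _ => rfl
  have h0 : IsPolynomialOn (a 0 (p + 1) p k) := (hinv.mul (hsum.add hw)).congr fun τ hτ => by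
    rw [eq_comm, one_div, inv_mul_eq_iff_eq_mul₀ hM]
    linear_combination -(next τ hτ).2.2 / 2 + expand τ
  have h2 : IsPolynomialOn (a 2 (p + 1) p k) := (hinv.mul (hsum.sub hw)).congr fun τ hτ => by
    rw [eq_comm, one_div, inv_mul_eq_iff_eq_mul₀ hM]
    linear_combination -(next τ hτ).2.2 / 2 - expand τ
  intro j
  fin_cases j
  exacts [h0, h1, h2]
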